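/- Let $k, t$ be positive integers, and let $B_{kt}$ be the Boolean lattice of all subsets of $[k]\times[t]$, ordered by inclusion. Let $K \le S_k$ and $T \le S_t$ be subgroups, each generated by powers of disjoint cycles, that is, each of the form $\langle \sigma_1^{r_1}, \dots, \sigma_m^{r_m}\rangle$ with $m \ge 0$, pairwise disjoint cycles $\sigma_1,\dots,\sigma_m$ and integers $r_i \ge 0$. Let $G = K \wr T$ be the group of all permutations $\phi$ of $[k]\times[t]$ of the form $$\phi(i,r) = (\rho_r(i), \tau(r)), \qquad \rho_1,\dots,\rho_t \in K,\ \tau \in T,$$ acting on $B_{kt}$ by $X \mapsto \phi(X)$. Let $B_{kt}/G$ be the set of $G$-orbits, ordered by $[X] \le [Y]$ if and only if $X' \subseteq Y'$ for some $X' \in [X]$ and $Y' \in [Y]$. Then $B_{kt}/G$ is a symmetric chain order. This means the following. It is a finite poset with a minimum element in which all maximal chains have the same length. Let $r(x)$ be the maximum length $|C|-1$ of a chain $C$ with maximum element $x$. Then the poset can be partitioned into chains, each of the form $x_0 \lessdot x_1 \lessdot \cdots \lessdot x_m$ with $m \ge 0$ (every $x_{j+1}$ covers $x_j$) and $r(x_0)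 + r(x_m) = \max_x r(x)$. -/

import Mathlib

/-- The poset `P` is finite, has a minimum element, and all its maximal chains have the same
length. -/
structure IsRankedPoset (P : Type*) [PartialOrder P] : Prop where
  finite : Finite P
  exists_min : ∃ a : P, ∀ x : P, a ≤ x
  maxChains : ∀ C D : Set P, IsMaxChain (· ≤ ·) C → IsMaxChain (· ≤ ·) D → C.ncard = D.ncard

/-- The rank of a poset: the maximum of the ranks `r(x)`, where `r(x)` is `Order.height x`, the
largest length of a chain with maximum element `x`. -/
noncomputable def posetRank (P : Type*) [PartialOrder P] : ℕ∞ := ⨆ x : P, Order.height x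

/-- `C` is the underlying set of a saturated chain `x 0 ⋖ x 1 ⋖ ⋯ ⋖ x m` of `P` such that the ranks
of its two ends add up to the rank of `P`. -/
def IsSymmetricChain {P : Type*} [PartialOrder P] (C : Set P) : Prop :=
  ∃ (m : ℕ) (x : Fin (m + 1) → P), (∀ i : Fin m, x i.castSucc ⋖ x i.succ) ∧
    Order.height (x 0) + Order.height (x (Fin.last m)) = posetRank P ∧ C = Set.range x

/-- A symmetric chain decomposition: a partition of `P` into symmetric chains. -/
def IsSymmetricChainDecomposition {P : Type*} [PartialOrder P] (D : Set (Set P)) : Prop :=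
  Setoid.IsPartition D ∧ ∀ C ∈ D, IsSymmetricChain C

/-- A symmetric chain order: a ranked poset that has a symmetric chain decomposition. -/
def IsSymmetricChainOrder (P : Type*) [PartialOrder P] : Prop :=
  IsRankedPoset P ∧ ∃ D : Set (Set P), IsSymmetricChainDecomposition D

/-- The set `P/G` of orbits of a subgroup `G` of the automorphism group of the poset `P`. -/
def QuotientPoset {P : Type*} [PartialOrder P] (G : Subgroup (P ≃o P)) : Type _ :=
  MulAction.orbitRel.Quotient G P

/-- The orbit of `x` as an element of `P/G`. -/
def QuotientPoset.mk {P : Type*} [PartialOrder P] (G : Subgroup (P ≃o P)) (x : P) :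
    QuotientPoset G :=
  Quotient.mk (MulAction.orbitRel G P) x

theorem QuotientPoset.mk_eq_mk_iff {P : Type*} [PartialOrder P] (G : Subgroup (P ≃o P)) (x y : P) :
    QuotientPoset.mk G x = QuotientPoset.mk G y ↔ ∃ g ∈ G, g y = x := by
  refine (Quotient.eq (r := MulAction.orbitRel G P)).trans ?_
  constructor
  · rintro ⟨⟨g, hg⟩, h⟩
    exact ⟨g, hg, h⟩
  · rintro ⟨g, hg, h⟩
    exact ⟨⟨g, hg⟩, h⟩

/-- An automorphism `g` of a finite poset fixes `x` as soon as `x ≤ g x`. -/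
theorem orderIso_apply_eq_of_le {P : Type*} [PartialOrder P] [Finite P] (g : P ≃o P) (x : P)
    (h : x ≤ g x) : g x = x := by
  have hmono : Monotone fun n : ℕ => (⇑g)^[n] x :=
    Monotone.monotone_iterate_of_le_map g.monotone h
  obtain ⟨n, hn, hp⟩ : ∃ n > 0, (⇑g)^[n] x = x :=
    Function.Injective.mem_periodicPts g.injective x
  refine le_antisymm ?_ h
  calc g x = (⇑g)^[1] x := rfl
    _ ≤ (⇑g)^[n] x := hmono hn
    _ = x := hp

/-- The order of the quotient poset: `[x] ≤ [y]` when `x' ≤ y'` for some `x' ∈ [x]`, `y' ∈ [y]`. -/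
instance QuotientPoset.instPartialOrder {P : Type*} [PartialOrder P] [Finite P]
    (G : Subgroup (P ≃o P)) : PartialOrder (QuotientPoset G) where
  le a b := ∃ x y : P, QuotientPoset.mk G x = a ∧ QuotientPoset.mk G y = b ∧ x ≤ y
  le_refl a := by
    obtain ⟨x, rfl⟩ := Quotient.exists_rep a
    exact ⟨x, x, rfl, rfl, le_rfl⟩
  le_trans a b c := by
    rintro ⟨x, y, rfl, rfl, hxy⟩ ⟨y', z, hy, rfl, hyz⟩
    obtain ⟨g, hg, rfl⟩ := (QuotientPoset.mk_eq_mk_iff G y' y).1 hy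
    exact ⟨g x, z, (QuotientPoset.mk_eq_mk_iff G _ _).2 ⟨g, hg, rfl⟩, rfl,
      (g.monotone hxy).trans hyz⟩
  le_antisymm a b := by
    rintro ⟨x, y, rfl, rfl, hxy⟩ ⟨y', x', hy, hx, hyx⟩
    obtain ⟨g, hg, rfl⟩ := (QuotientPoset.mk_eq_mk_iff G y' y).1 hy
    obtain ⟨f, hf, rfl⟩ := (QuotientPoset.mk_eq_mk_iff G x' x).1 hx
    have h1 : x ≤ (g⁻¹ * f) x := by
      refine hxy.trans ?_
      have := (g⁻¹ : P ≃o P).monotone hyx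
      rwa [← RelIso.mul_apply, inv_mul_cancel, RelIso.one_apply, ← RelIso.mul_apply] at this
    have h2 := orderIso_apply_eq_of_le _ _ h1
    have h3 : f x = g x := by
      have := congrArg (⇑g) h2
      rwa [← RelIso.mul_apply, mul_inv_cancel_left] at this
    rw [h3] at hyx
    have h4 : x = y := le_antisymm hxy ((map_le_map_iff g).1 hyx)
    rw [h4]

/-- The subgroup `K` of the symmetric group on `α` is generated by powers of disjoint cycles:
`K = ⟨σ₁ ^ r₁, …, σₘ ^ rₘ⟩` for pairwise disjoint cycles `σ₁, …, σₘ`. -/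
def IsGeneratedByPowersOfDisjointCycles {α : Type*} (K : Subgroup (Equiv.Perm α)) : Prop :=
  ∃ (m : ℕ) (σ : Fin m → Equiv.Perm α) (r : Fin m → ℕ),
    (∀ i, (σ i).IsCycle) ∧ (∀ i j, i ≠ j → (σ i).Disjoint (σ j)) ∧
    K = Subgroup.closure (Set.range fun i => σ i ^ r i)

/-- The wreath product `K ≀ T`, as a group of permutations of `α × β`: all the maps
`(i, r) ↦ (ρ r i, τ r)` with `ρ r ∈ K` for every `r`, and `τ ∈ T`. -/
def wreathProduct {α β : Type*} (K : Subgroup (Equiv.Perm α)) (T : Subgroup (Equiv.Perm β)) :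
    Subgroup (Equiv.Perm (α × β)) where
  carrier := {φ | ∃ (ρ : β → Equiv.Perm α) (τ : Equiv.Perm β), (∀ r, ρ r ∈ K) ∧ τ ∈ T ∧
    ∀ i r, φ (i, r) = (ρ r i, τ r)}
  mul_mem' := by
    rintro φ ψ ⟨ρ, τ, hρ, hτ, hφ⟩ ⟨ρ', τ', hρ', hτ', hψ⟩
    exact ⟨fun r => ρ (τ' r) * ρ' r, τ * τ', fun r => K.mul_mem (hρ _) (hρ' _),
      T.mul_mem hτ hτ', fun i r => by simp [hφ, hψ]⟩
  one_mem' := ⟨fun _ => 1, 1, fun _ => K.one_mem, T.one_mem, fun _ _ => rfl⟩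
  inv_mem' := by
    rintro φ ⟨ρ, τ, hρ, hτ, hφ⟩
    refine ⟨fun r => (ρ (τ⁻¹ r))⁻¹, τ⁻¹, fun r => K.inv_mem (hρ _), T.inv_mem hτ, fun i r => ?_⟩
    rw [Equiv.Perm.inv_eq_iff_eq, hφ]
    simp

/-- A permutation `φ` of `α` acts on the Boolean lattice of subsets of `α` by
`X ↦ φ(X) = {φ a | a ∈ X}`; this is a homomorphism to the automorphism group of that lattice. -/
def permToAut (α : Type*) : Equiv.Perm α →* (Set α ≃o Set α) where
  toFun φ := φ.toOrderIsoSet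
  map_one' := by
    refine RelIso.ext fun X => ?_
    exact Set.image_id X
  map_mul' φ ψ := by
    refine RelIso.ext fun X => ?_
    exact Set.image_comp φ ψ X

/-!
Call a poset with a rank function and an equivalence relation *decomposable* if its quotient splits
into saturated chains symmetric about the middle rank (`HasSCD`). Identifying a subset of
`[k] × [t]` with a function `[t] → ([k] → Prop)`, the theorem follows by applying twice, first with
`P = Prop` and the group `K`, then with `P` the set of functions `[k] → Prop` modulo `K` and the
group `T`, the following statement (`HasSCD.fun_of_disjoint_cycles`): if `P` is decomposable and `T`
is generated by powers of disjoint cycles, then `β → P` modulo `T` is decomposable. Splitting `β`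
into the supports of the cycles and the fixed points writes this quotient as a product, and products
of symmetric chain decompositions exist (`HasSCD.prod`). On each factor a cyclic group acts freely
on the coordinates, since a power of a cycle that fixes a point of the support is the identity.

So let `G` be cyclic, acting freely on `I`. Labelling the values of a function `I → P` by the chains
of `P` that contain them cuts `(I → P) / G` into boxes `∏ i, [0, k i]` modulo the stabilizer of the
labelling (`HasSCD.fun_of_box`), all of them centred at the same rank. The boxes are treated by
induction on `|G|` (`freeBoxesHaveSCD_of_isCyclic`). A box on `I ≅ J × G` is the set of words on `G`
with letters in a box on `J`; labelling again by chains, either the stabilizer is a proper subgroup,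
or the labelling is constant and what remains are the cyclic words over one chain `[0, l]` up to
rotation. Such a word is cut at the places `i` where the preceding letter is not `l` and the letter
at `i` is not `0`; between cuts it reads `l, …, l, c, 0, …, 0` and is determined by the sum of its
letters. Words with a given cut set `A` therefore form again a box, with a coordinate in
`[1, l * len - 1]` for each segment between cuts, centred at the middle rank, and only the
stabilizer of `A` acts on it. This is a proper subgroup (induction on `|G|`), or every place is a
cut and the letters are those of `[1, l - 1]` (induction on `l`). The words with at most one cut
form a single symmetric chain (`boxHasSCD_word`).
-/

/-! ### Symmetric chain decompositions modulo an equivalence relation -/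

/-- `X` modulo `E` has a symmetric chain decomposition with respect to the rank function `ρ`, with
ranks symmetric about `N / 2`. The chains are indexed by `ι`; the `i`-th one is
`e i 0 ≤ e i 1 ≤ ⋯ ≤ e i (m i)`, a chain of representatives in `X` itself, whose ranks are
`c i, c i + 1, …, c i + m i`. The values `e i j` with `m i < j` are irrelevant. -/
def HasSCD {X : Type} [Preorder X] (E : Setoid X) (ρ : X → ℤ) (N : ℤ) : Prop :=
  ∃ (ι : Type) (m : ι → ℕ) (c : ι → ℤ) (e : ι → ℕ → X),
    (∀ x, ∃ i, ∃ j ≤ m i, E (e i j) x) ∧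
    (∀ i j i' j', j ≤ m i → j' ≤ m i' → E (e i j) (e i' j') → i = i' ∧ j = j') ∧
    (∀ i, ∀ j < m i, e i j ≤ e i (j + 1)) ∧
    (∀ i, ∀ j ≤ m i, ρ (e i j) = c i + j) ∧
    ∀ i, 2 * c i + m i = N

namespace HasSCD

/-- If `Y` modulo `E` is, as a set, the disjoint union of the images of monotone maps `f a` that
shift ranks by `δ a`, then decompositions of the pieces, with the same centre after the shift, join
to one of `Y`. No relation between the orders of different pieces is needed. -/
theorem glue {A : Type} {X : A → Type} [∀ a, Preorder (X a)] {Y : Type} [Preorder Y]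
    {E : ∀ a, Setoid (X a)} {ρ : ∀ a, X a → ℤ} {n : A → ℤ} {F : Setoid Y} {ρY : Y → ℤ} {N : ℤ}
    (h : ∀ a, HasSCD (E a) (ρ a) (n a)) (f : ∀ a, X a → Y) (δ : A → ℤ)
    (hmono : ∀ a, Monotone (f a)) (hρ : ∀ a x, ρY (f a x) = ρ a x + δ a)
    (hN : ∀ a, n a + 2 * δ a = N)
    (hne : ∀ a b x y, F (f a x) (f b y) → a = b)
    (hE : ∀ a x y, F (f a x) (f a y) ↔ E a x y)
    (hsurj : ∀ y, ∃ a x, F (f a x) y) : HasSCD F ρY N := by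
  choose ι m c e h1 h2 h3 h4 h5 using h
  refine ⟨Σ a, ι a, fun p => m p.1 p.2, fun p => c p.1 p.2 + δ p.1,
    fun p j => f p.1 (e p.1 p.2 j), ?_, ?_, ?_, ?_, ?_⟩
  · intro y
    obtain ⟨a, x, hx⟩ := hsurj y
    obtain ⟨i, j, hj, hij⟩ := h1 a x
    exact ⟨⟨a, i⟩, j, hj, F.trans ((hE a _ _).2 hij) hx⟩
  · rintro ⟨a, i⟩ j ⟨b, i'⟩ j' hj hj' hF
    obtain rfl := hne _ _ _ _ hF
    obtain ⟨rfl, rfl⟩ := h2 a i j i' j' hj hj' ((hE a _ _).1 hF)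
    exact ⟨rfl, rfl⟩
  · rintro ⟨a, i⟩ j hj
    exact hmono a (h3 a i j hj)
  · rintro ⟨a, i⟩ j hj
    change ρY (f a (e a i j)) = c a i + δ a + j
    rw [hρ, h4 a i j hj]
    ring
  · rintro ⟨a, i⟩
    have := h5 a i
    have := hN a
    change 2 * (c a i + δ a) + m a i = N
    linarith

/-- A monotone map that induces a bijection of the quotients and shifts ranks by a constant carries
a decomposition along; its inverse need not be monotone. -/
theorem transfer {X Y : Type} [Preorder X] [Preorder Y] {E : Setoid X} {ρ : X → ℤ} {n : ℤ}
    {F : Setoid Y} {ρY : Y → ℤ} {N : ℤ} (h : HasSCD E ρ n) (f : X → Y) (δ : ℤ)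
    (hmono : Monotone f) (hρ : ∀ x, ρY (f x) = ρ x + δ) (hN : n + 2 * δ = N)
    (hE : ∀ x y, F (f x) (f y) ↔ E x y) (hsurj : ∀ y, ∃ x, F (f x) y) : HasSCD F ρY N :=
  glue (A := Unit) (fun _ => h) (fun _ => f) (fun _ => δ) (fun _ => hmono) (fun _ => hρ)
    (fun _ => hN) (fun _ _ _ _ _ => rfl) (fun _ => hE) fun y => ⟨(), hsurj y⟩

/-- The case of `glue` in which the pieces are the fibres of an invariant `π`. -/
theorem of_fibers {A X : Type} [Preorder X] {E : Setoid X} {ρ : X → ℤ} {N : ℤ} (π : X → A)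
    (hπ : ∀ x y, E x y → π x = π y)
    (h : ∀ a, HasSCD (E.comap (Subtype.val : {x // π x = a} → X)) (fun x => ρ x.1) N) :
    HasSCD E ρ N :=
  glue h (fun _ => Subtype.val) (fun _ => 0) (fun _ _ _ h => h) (fun _ _ => (add_zero _).symm)
    (fun _ => by simp) (fun a b x y hxy => by rw [← x.2, ← y.2]; exact hπ _ _ hxy)
    (fun _ _ _ => Iff.rfl) fun y => ⟨π y, ⟨y, rfl⟩, E.refl _⟩

theorem of_isEmpty {X : Type} [Preorder X] [IsEmpty X] (E : Setoid X) (ρ : X → ℤ) (N : ℤ) :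
    HasSCD E ρ N :=
  ⟨Empty, Empty.elim, Empty.elim, Empty.elim, fun x => isEmptyElim x, fun i => i.elim,
    fun i => i.elim, fun i => i.elim, fun i => i.elim⟩

theorem of_chain {X : Type} [Preorder X] {E : Setoid X} {ρ : X → ℤ} (m : ℕ) (e : ℕ → X)
    (hinv : ∀ x y, E x y → ρ x = ρ y) (hsurj : ∀ x, ∃ j ≤ m, E (e j) x)
    (hmono : ∀ j < m, e j ≤ e (j + 1)) (hρ : ∀ j ≤ m, ρ (e j) = j) : HasSCD E ρ m := by
  refine ⟨Unit, fun _ => m, fun _ => 0, fun _ => e, fun x => ⟨(), hsurj x⟩, ?_,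
    fun _ => hmono, fun _ j hj => by simp [hρ j hj], fun _ => by simp⟩
  intro _ j _ j' hj hj' h
  have := hinv _ _ h
  rw [hρ j hj, hρ j' hj'] at this
  exact ⟨rfl, by exact_mod_cast this⟩

/-- The rectangle `[0, a] × [0, b]` splits into the hooks
`(0, t), …, (a - t, t), (a - t, t + 1), …, (a - t, b)`, one for each `t ≤ min a b`; applied to each
pair of chains this decomposes a product. -/
theorem prod {X Y : Type} [Preorder X] [Preorder Y] {E : Setoid X} {F : Setoid Y} {ρ : X → ℤ}
    {ρ' : Y → ℤ} {N N' : ℤ} (hX : HasSCD E ρ N) (hY : HasSCD F ρ' N') :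
    HasSCD (E.prod F) (fun p => ρ p.1 + ρ' p.2) (N + N') := by
  obtain ⟨ι, m, c, e, h1, h2, h3, h4, h5⟩ := hX
  obtain ⟨ι', m', c', e', h1', h2', h3', h4', h5'⟩ := hY
  refine ⟨{q : ι × ι' × ℕ // q.2.2 ≤ m q.1 ∧ q.2.2 ≤ m' q.2.1},
    fun q => (m q.1.1 - q.1.2.2) + (m' q.1.2.1 - q.1.2.2),
    fun q => c q.1.1 + c' q.1.2.1 + q.1.2.2,
    fun q p => (e q.1.1 (min p (m q.1.1 - q.1.2.2)),
      e' q.1.2.1 (q.1.2.2 + (p - (m q.1.1 - q.1.2.2)))), ?_, ?_, ?_, ?_, ?_⟩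
  · rintro ⟨x, y⟩
    obtain ⟨i, a, ha, hx⟩ := h1 x
    obtain ⟨i', b, hb, hy⟩ := h1' y
    by_cases hab : a + b ≤ m i
    · refine ⟨⟨(i, i', b), by dsimp only; omega, hb⟩, a, by dsimp only; omega, ?_, ?_⟩
      · dsimp only
        rwa [min_eq_left (by omega)]
      · dsimp only
        rwa [show b + (a - (m i - b)) = b by omega]
    · refine ⟨⟨(i, i', m i - a), by dsimp only; omega, by dsimp only; omega⟩,
        a + (b - (m i - a)), by dsimp only; omega, ?_, ?_⟩
      · dsimp only
        rwa [show min (a + (b - (m i - a))) (m i - (m i - a)) = a by omega]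
      · dsimp only
        rwa [show m i - a + (a + (b - (m i - a)) - (m i - (m i - a))) = b by omega]
  · rintro ⟨⟨i, i', t⟩, ht, ht'⟩ p ⟨⟨k, k', s⟩, hs, hs'⟩ q hp hq ⟨hx, hy⟩
    change t ≤ m i at ht
    change t ≤ m' i' at ht'
    change s ≤ m k at hs
    change s ≤ m' k' at hs'
    dsimp only at hp hq hx hy
    obtain ⟨rfl, hx⟩ := h2 _ _ _ _ (by omega) (by omega) hx
    obtain ⟨rfl, hy⟩ := h2' _ _ _ _ (by omega) (by omega) hy
    obtain ⟨rfl, rfl⟩ : t = s ∧ p = q := by omega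
    exact ⟨rfl, rfl⟩
  · rintro ⟨⟨i, i', t⟩, ht, ht'⟩ p hp
    change t ≤ m i at ht
    change t ≤ m' i' at ht'
    dsimp only at hp ⊢
    by_cases h : p < m i - t
    · rw [min_eq_left (by omega), min_eq_left (by omega),
        show p + 1 - (m i - t) = 0 by omega, show p - (m i - t) = 0 by omega]
      exact ⟨h3 _ _ (by omega), le_rfl⟩
    · rw [min_eq_right (by omega), min_eq_right (by omega),
        show t + (p + 1 - (m i - t)) = t + (p - (m i - t)) + 1 by omega]
      exact ⟨le_rfl, h3' _ _ (by omega)⟩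
  · rintro ⟨⟨i, i', t⟩, ht, ht'⟩ p hp
    change t ≤ m i at ht
    change t ≤ m' i' at ht'
    dsimp only at hp ⊢
    rw [h4 _ _ (by omega), h4' _ _ (by omega)]
    omega
  · rintro ⟨⟨i, i', t⟩, ht, ht'⟩
    change t ≤ m i at ht
    change t ≤ m' i' at ht'
    dsimp only
    have := h5 i
    have := h5' i'
    omega

theorem pi (κ : Type) [Fintype κ] : ∀ (X : κ → Type) [∀ k, Preorder (X k)]
    (E : ∀ k, Setoid (X k)) (ρ : ∀ k, X k → ℤ) (N : κ → ℤ), (∀ k, HasSCD (E k) (ρ k) (N k)) →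
    HasSCD (@piSetoid _ _ E) (fun x => ∑ k, ρ k (x k)) (∑ k, N k) := by
  refine Fintype.induction_empty_option (P := fun κ _ => ∀ (X : κ → Type) [∀ k, Preorder (X k)]
    (E : ∀ k, Setoid (X k)) (ρ : ∀ k, X k → ℤ) (N : κ → ℤ), (∀ k, HasSCD (E k) (ρ k) (N k)) →
    HasSCD (@piSetoid _ _ E) (fun x => ∑ k, ρ k (x k)) (∑ k, N k)) ?_ ?_ ?_ κ
  · intro α β _ f ih X _ E ρ N h
    let _ : Fintype α := Fintype.ofEquiv β f.symm
    refine (ih (fun a => X (f a)) (fun a => E (f a)) (fun a => ρ (f a)) (fun a => N (f a))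
      fun a => h (f a)).transfer (Equiv.piCongrLeft X f) 0 ?_ ?_ ?_ ?_ ?_
    · intro x y hxy b
      obtain ⟨a, rfl⟩ := f.surjective b
      simpa using hxy a
    · intro x
      rw [add_zero, ← f.sum_comp]
      simp
    · rw [mul_zero, add_zero, ← f.sum_comp]
    · refine fun x y => ⟨fun hxy a => ?_, fun hxy b => ?_⟩
      · simpa using hxy (f a)
      · obtain ⟨a, rfl⟩ := f.surjective b
        simpa using hxy a
    · intro y
      refine ⟨fun a => y (f a), fun b => ?_⟩
      obtain ⟨a, rfl⟩ := f.surjective b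
      simp
  · intro X _ E ρ N _
    have := of_chain (E := @piSetoid _ _ E) (ρ := fun x => ∑ k, ρ k (x k)) 0 (fun _ k => k.elim)
      (fun _ _ _ => by simp) (fun x => ⟨0, le_rfl, fun k => k.elim⟩) (fun j hj => by omega)
      (fun j hj => by obtain rfl : j = 0 := by omega
                      simp)
    simpa using this
  · intro α _ ih X _ E ρ N h
    refine ((h none).prod (ih (fun a => X (some a)) (fun a => E (some a)) (fun a => ρ (some a))
      (fun a => N (some a)) fun a => h (some a))).transfer
      (fun p => fun o => Option.rec p.1 p.2 o) 0 ?_ ?_ ?_ ?_ ?_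
    · rintro x y ⟨h0, h1⟩ (_ | a)
      exacts [h0, h1 a]
    · intro x
      simp
    · simp
    · refine fun x y => ⟨fun hxy => ⟨hxy none, fun a => hxy (some a)⟩, ?_⟩
      rintro ⟨h0, h1⟩ (_ | a)
      exacts [h0, h1 a]
    · refine fun y => ⟨(y none, fun a => y (some a)), ?_⟩
      rintro (_ | a)
      exacts [(E _).refl _, (E _).refl _]

end HasSCD

/-! ### Functions up to a group permuting the arguments -/

/-- The functions `x y : I → P` are equivalent when some `g : G` permuting the arguments takes
`x` to `y`, up to a given equivalence relation on the values. -/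
def orbitSetoid (G I : Type) {P : Type} [Group G] [MulAction G I] (E : Setoid P) :
    Setoid (I → P) where
  r x y := ∃ g : G, ∀ i, E (x i) (y (g • i))
  iseqv :=
    { refl := fun x => ⟨1, fun i => by rw [one_smul]⟩
      symm := by
        rintro x y ⟨g, h⟩
        exact ⟨g⁻¹, fun i => by simpa using E.symm (h (g⁻¹ • i))⟩
      trans := by
        rintro x y z ⟨g, h⟩ ⟨g', h'⟩
        exact ⟨g' * g, fun i => by rw [mul_smul]; exact E.trans (h i) (h' _)⟩ }

/-- Equality up to the action of `G` on the points of the box `∏ i, [0, k i]`. -/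
def boxSetoid (G : Type) {I : Type} [Group G] [MulAction G I] (k : I → ℕ) : Setoid (Set.Iic k) :=
  (orbitSetoid G I (⊥ : Setoid ℕ)).comap Subtype.val

/-- The box `∏ i, [0, k i]` modulo `G` has a symmetric chain decomposition. -/
def BoxHasSCD (G : Type) {I : Type} [Group G] [MulAction G I] [Fintype I] (k : I → ℕ) : Prop :=
  HasSCD (boxSetoid G k) (fun x => ∑ i, (x.1 i : ℤ)) (∑ i, (k i : ℤ))

/-- The subgroup of the elements that preserve the labelling `w`. -/
def labelStabilizer (G : Type) {I W : Type} [Group G] [MulAction G I] (w : I → W) :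
    Subgroup G where
  carrier := {g | ∀ i, w i = w (g • i)}
  one_mem' i := by rw [one_smul]
  mul_mem' := by
    intro a b ha hb i
    rw [mul_smul, ← ha, ← hb]
  inv_mem' := by
    intro a ha i
    rw [ha (a⁻¹ • i), smul_inv_smul]

/-- A chain decomposition of `P` labels each coordinate of a function `I → P` by a chain. The
functions with a given labelling `w` form a box, on which only the stabilizer of `w` still acts. -/
theorem HasSCD.fun_of_box {G I P : Type} [Group G] [MulAction G I] [Fintype I] [Preorder P]
    {E : Setoid P} {ρ : P → ℤ} {N : ℤ} (hP : HasSCD E ρ N)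
    (h : ∀ (W : Type) (w : I → W) (m : W → ℕ),
      BoxHasSCD (labelStabilizer G w) (fun i => m (w i))) :
    HasSCD (orbitSetoid G I E) (fun x => ∑ i, ρ (x i)) (∑ _i : I, N) := by
  obtain ⟨ι, m, c, e, h1, h2, h3, h4, h5⟩ := hP
  have hmono : ∀ i a b, a ≤ b → b ≤ m i → e i a ≤ e i b := by
    intro i a b hab hb
    induction b, hab using Nat.le_induction with
    | base => exact le_rfl
    | succ b _ ih => exact (ih (by omega)).trans (h3 i b (by omega))
  let A := Quotient (orbitSetoid G I (⊥ : Setoid ι))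
  refine HasSCD.glue (A := A) (fun a => h ι a.out m) (fun a y i => e (a.out i) (y.1 i))
    (fun a => ∑ i, c (a.out i)) ?_ ?_ ?_ ?_ ?_ ?_
  · intro a x y hxy i
    exact hmono _ _ _ (hxy i) (y.2 i)
  · intro a x
    rw [← Finset.sum_add_distrib]
    refine Finset.sum_congr rfl fun i _ => ?_
    rw [h4 _ _ (x.2 i), add_comm]
  · intro a
    rw [Finset.mul_sum, ← Finset.sum_add_distrib]
    refine Finset.sum_congr rfl fun i _ => ?_
    rw [← h5 (a.out i), add_comm]
  · rintro a b x y ⟨g, hg⟩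
    rw [← a.out_eq, ← b.out_eq]
    exact Quotient.sound ⟨g, fun i => (h2 _ _ _ _ (x.2 i) (y.2 _) (hg i)).1⟩
  · intro a x y
    constructor
    · rintro ⟨g, hg⟩
      have key := fun i => h2 _ _ _ _ (x.2 i) (y.2 _) (hg i)
      exact ⟨⟨g, fun i => (key i).1⟩, fun i => (key i).2⟩
    · rintro ⟨⟨g, hg⟩, hg'⟩
      refine ⟨g, fun i => ?_⟩
      have h1 : a.out i = a.out (g • i) := hg i
      have h2 : x.1 i = y.1 (g • i) := hg' i
      change E (e (a.out i) (x.1 i)) (e (a.out (g • i)) (y.1 (g • i)))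
      rw [h1, h2]
  · intro y
    choose w j hj hw using fun i => h1 (y i)
    obtain ⟨g, hg⟩ : ∃ g : G, ∀ i,
        (Quotient.mk (orbitSetoid G I (⊥ : Setoid ι)) w).out i = w (g • i) :=
      Quotient.mk_out (s := orbitSetoid G I (⊥ : Setoid ι)) w
    refine ⟨Quotient.mk _ w, ⟨fun i => j (g • i), fun i => ?_⟩, g, fun i => ?_⟩
    · change j (g • i) ≤ m _
      rw [hg]
      exact hj _
    · change E (e _ (j (g • i))) _
      rw [hg]
      exact hw _

/-! ### Cyclic words cut at a set of places -/

section Cut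

variable {G : Type} [Group G]

/-- The places where a word `x : G → [0, l]` on the cycle generated by `z` is cut: `i` is a cut if
the letter before it is not the largest and the letter at `i` is not the smallest. Between cuts the
word has the form `l, …, l, c, 0, …, 0`. -/
def cutSet (z : G) (l : ℕ) (x : G → ℕ) : Set G := {i | x (i * z⁻¹) < l ∧ 0 < x i}

/-- The number of steps from `i` back to the last element of `A` at or before `i`. -/
noncomputable def backDist (z : G) (A : Set G) (i : G) : ℕ := sInf {j | i * (z ^ j)⁻¹ ∈ A}

/-- The last element of `A` at or before `i`. -/
noncomputable def segStart (z : G) (A : Set G) (i : G) : G := i * (z ^ backDist z A i)⁻¹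

/-- The number of steps from `a` to the next element of `A` after it. -/
noncomputable def segLength (z : G) (A : Set G) (a : G) : ℕ := sInf {j | 0 < j ∧ a * z ^ j ∈ A}

/-- The word that on each segment between consecutive elements of `A` reads `l, …, l, c, 0, …, 0`,
with sum `s a` on the segment that starts at `a`. -/
noncomputable def segWord (z : G) (A : Set G) (l : ℕ) (s : G → ℕ) (i : G) : ℕ :=
  min l (s (segStart z A i) - l * backDist z A i)

variable {z : G} {A : Set G} {l : ℕ}

theorem sum_range_min_sub (l s : ℕ) : ∀ L, ∑ j ∈ Finset.range L, min l (s - l * j) = min s (l * L)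
  | 0 => by simp
  | L + 1 => by
    rw [Finset.sum_range_succ, sum_range_min_sub l s L, mul_add, mul_one]
    omega

/-- A sequence of the form `l, …, l, c, 0, …, 0` is determined by its sum. -/
theorem eq_min_sub_of_sum (l : ℕ) : ∀ (L : ℕ) (y : ℕ → ℕ), (∀ j, y j ≤ l) →
    (∀ j, j + 1 < L → y j = l ∨ y (j + 1) = 0) →
    ∀ j < L, y j = min l ((∑ i ∈ Finset.range L, y i) - l * j)
  | 0, _, _, _, j, hj => by omega
  | L + 1, y, hl, h, j, hj => by
    have ih := eq_min_sub_of_sum l L (fun i => y (i + 1)) (fun i => hl _)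
      fun i hi => h (i + 1) (by omega)
    rw [Finset.sum_range_succ']
    have h0 := hl 0
    by_cases hy : y 0 = l
    · cases j with
      | zero => rw [mul_zero]; omega
      | succ j =>
        rw [ih j (by omega), hy, mul_add, mul_one]
        congr 1
        omega
    · have hz : ∀ i < L, y (i + 1) = 0 := by
        intro i
        induction i with
        | zero => exact fun hi => (h 0 (by omega)).resolve_left hy
        | succ i ih' =>
          intro hi
          refine (h (i + 1) (by omega)).resolve_left fun h' => ?_
          have := ih' (by omega)
          omega
      rw [Finset.sum_eq_zero fun i hi => hz i (Finset.mem_range.1 hi), zero_add]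
      cases j with
      | zero => rw [mul_zero]; omega
      | succ j =>
        rw [hz j (by omega), mul_add, mul_one]
        omega

theorem segStart_mul_pow (i : G) : segStart z A i * z ^ backDist z A i = i :=
  inv_mul_cancel_right _ _

theorem mul_pow_notMem {a : G} {j : ℕ} (h0 : 0 < j) (hj : j < segLength z A a) :
    a * z ^ j ∉ A := fun h => Nat.notMem_of_lt_sInf hj ⟨h0, h⟩

theorem backDist_mul_pow {a : G} (ha : a ∈ A) {j : ℕ} (hj : j < segLength z A a) :
    backDist z A (a * z ^ j) = j := by
  refine le_antisymm (Nat.sInf_le (by simpa using ha)) ?_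
  refine le_csInf ⟨j, by simpa using ha⟩ fun j' hj' => ?_
  by_contra! hlt
  refine mul_pow_notMem (z := z) (A := A) (a := a) (j := j - j') (by omega) (by omega) ?_
  convert (show a * z ^ j * (z ^ j')⁻¹ ∈ A from hj') using 1
  rw [mul_assoc]
  congr 1
  rw [eq_mul_inv_iff_mul_eq, ← pow_add]
  congr 1
  omega

theorem segStart_mul_pow_of_lt {a : G} (ha : a ∈ A) {j : ℕ} (hj : j < segLength z A a) :
    segStart z A (a * z ^ j) = a := by
  rw [segStart, backDist_mul_pow ha hj, mul_inv_cancel_right]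

theorem segWord_mul_pow {s : G → ℕ} {a : G} (ha : a ∈ A) {j : ℕ} (hj : j < segLength z A a) :
    segWord z A l s (a * z ^ j) = min l (s a - l * j) := by
  rw [segWord, segStart_mul_pow_of_lt ha hj, backDist_mul_pow ha hj]

theorem sum_segWord_segment {s : G → ℕ} {a : G} (ha : a ∈ A) (hs : s a ≤ l * segLength z A a) :
    ∑ j ∈ Finset.range (segLength z A a), segWord z A l s (a * z ^ j) = s a := by
  rw [Finset.sum_congr rfl fun j hj => segWord_mul_pow ha (Finset.mem_range.1 hj),
    sum_range_min_sub, min_eq_left hs]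

section Finite

variable [Finite G] (hz : ∀ g : G, g ∈ Subgroup.zpowers z) (hA : A.Nonempty)
include hz

theorem exists_mul_pow_eq (a b : G) : ∃ j, a * z ^ j = b := by
  obtain ⟨j, hj⟩ := mem_powers_iff_mem_zpowers.2 (hz (a⁻¹ * b))
  exact ⟨j, by rw [show z ^ j = a⁻¹ * b from hj, mul_inv_cancel_left]⟩

include hA

theorem segStart_mem (i : G) : segStart z A i ∈ A := by
  obtain ⟨a, ha⟩ := hA
  obtain ⟨j, hj⟩ := exists_mul_pow_eq hz a i
  exact Nat.sInf_mem (s := {j | i * (z ^ j)⁻¹ ∈ A}) ⟨j, by simpa [← hj] using ha⟩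

theorem segLength_spec (a : G) : 0 < segLength z A a ∧ a * z ^ segLength z A a ∈ A := by
  obtain ⟨b, hb⟩ := hA
  obtain ⟨j, hj⟩ := exists_mul_pow_eq hz (a * z) b
  exact Nat.sInf_mem (s := {j | 0 < j ∧ a * z ^ j ∈ A})
    ⟨j + 1, j.succ_pos, by rwa [pow_succ', ← mul_assoc, hj]⟩

theorem backDist_lt (i : G) : backDist z A i < segLength z A (segStart z A i) := by
  by_contra! hle
  obtain ⟨h0, h1⟩ := segLength_spec hz hA (segStart z A i)
  have : backDist z A i ≤ backDist z A i - segLength z A (segStart z A i) := by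
    refine Nat.sInf_le ?_
    change _ ∈ A
    convert h1 using 1
    rw [mul_inv_eq_iff_eq_mul, mul_assoc, ← pow_add, Nat.add_sub_cancel' hle, segStart_mul_pow]
  omega

/-- The segments starting at the elements of `A` partition the cycle. -/
theorem sum_eq_sum_segment [Fintype G] [Fintype A] (x : G → ℕ) :
    ∑ i, x i = ∑ a : A, ∑ j ∈ Finset.range (segLength z A a), x (a * z ^ j) := by
  rw [Finset.sum_sigma']
  refine Finset.sum_bij' (fun i _ => ⟨⟨segStart z A i, segStart_mem hz hA i⟩, backDist z A i⟩)
    (fun p _ => p.1 * z ^ p.2) ?_ ?_ ?_ ?_ ?_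
  · intro i _
    simpa using backDist_lt hz hA i
  · simp
  · intro i _
    exact segStart_mul_pow i
  · rintro ⟨⟨a, ha⟩, j⟩ hj
    have hj : j < segLength z A a := by simpa using hj
    have h1 := segStart_mul_pow_of_lt ha hj
    have h2 := backDist_mul_pow ha hj
    dsimp only
    simp only [h1, h2]
  · intro i _
    exact congrArg x (segStart_mul_pow i).symm

theorem sum_segWord [Fintype G] [Fintype A] {s : G → ℕ}
    (hs : ∀ a ∈ A, s a ≤ l * segLength z A a) : ∑ i, segWord z A l s i = ∑ a : A, s a := by
  rw [sum_eq_sum_segment hz hA]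
  exact Finset.sum_congr rfl fun a _ => sum_segWord_segment a.2 (hs a a.2)

theorem sum_segLength [Fintype G] [Fintype A] :
    ∑ a : A, segLength z A a = Fintype.card G := by
  have := sum_eq_sum_segment hz hA (fun _ => 1)
  simpa using this.symm

/-- A word whose cuts lie in `A` is determined by its sums over the segments. -/
theorem eq_segWord {x : G → ℕ} (hx : ∀ i, x i ≤ l) (hcut : cutSet z l x ⊆ A) (i : G) :
    x i = segWord z A l (fun a => ∑ j ∈ Finset.range (segLength z A a), x (a * z ^ j)) i := by
  have := eq_min_sub_of_sum l (segLength z A (segStart z A i))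
    (fun j => x (segStart z A i * z ^ j)) (fun _ => hx _) ?_ _ (backDist_lt hz hA i)
  · rwa [segStart_mul_pow] at this
  · intro j hj
    by_contra! h
    refine mul_pow_notMem (z := z) j.succ_pos hj
      (hcut ⟨lt_of_le_of_ne (hx _) ?_, Nat.pos_of_ne_zero h.2⟩)
    convert h.1 using 2
    rw [pow_succ, ← mul_assoc, mul_inv_cancel_right]

theorem cutSet_segWord_subset (s : G → ℕ) : cutSet z l (segWord z A l s) ⊆ A := by
  rintro i ⟨h1, h2⟩
  by_contra hi
  have hlt := backDist_lt hz hA i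
  have hmem := segStart_mem hz hA i
  have hi' := segStart_mul_pow (z := z) (A := A) i
  obtain ⟨j, hj⟩ : ∃ j, backDist z A i = j + 1 := by
    refine Nat.exists_eq_succ_of_ne_zero fun h0 => hi ?_
    rw [h0, pow_zero, mul_one] at hi'
    rwa [← hi']
  rw [hj] at hi' hlt
  rw [← hi', segWord_mul_pow hmem hlt, mul_add, mul_one] at h2
  rw [← hi', pow_succ, ← mul_assoc, mul_inv_cancel_right,
    segWord_mul_pow hmem (by omega)] at h1
  omega

theorem cutSet_segWord {s : G → ℕ} (h0 : ∀ a ∈ A, 0 < s a)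
    (h1 : ∀ a ∈ A, s a < l * segLength z A a) : cutSet z l (segWord z A l s) = A := by
  refine (cutSet_segWord_subset hz hA s).antisymm fun a ha => ⟨?_, ?_⟩
  · have hlt := backDist_lt hz hA (a * z⁻¹)
    have hmem := segStart_mem hz hA (a * z⁻¹)
    have hi := segStart_mul_pow (z := z) (A := A) (a * z⁻¹)
    have hs := h1 _ hmem
    -- `a` is the end of the segment that contains its predecessor
    have hlen : segLength z A (segStart z A (a * z⁻¹)) ≤ backDist z A (a * z⁻¹) + 1 := by
      refine Nat.sInf_le ⟨Nat.succ_pos _, ?_⟩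
      rwa [pow_succ, ← mul_assoc, hi, inv_mul_cancel_right]
    have := hs.trans_le (Nat.mul_le_mul_left l hlen)
    rw [mul_add, mul_one] at this
    have hl : l ≠ 0 := by rintro rfl; simp at hs
    rw [segWord]
    omega
  · have hlen := (segLength_spec hz hA a).1
    have := segWord_mul_pow (l := l) (s := s) ha hlen
    rw [pow_zero, mul_one, mul_zero] at this
    have h3 := h1 a ha
    have h4 := h0 a ha
    have : l ≠ 0 := by rintro rfl; simp at h3
    omega

/-- A segment of a word between two cuts has neither the smallest nor the largest possible sum. -/
theorem segSum_bounds {x : G → ℕ} (hx : ∀ i, x i ≤ l) (hcut : cutSet z l x = A) {a : G}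
    (ha : a ∈ A) : 0 < ∑ j ∈ Finset.range (segLength z A a), x (a * z ^ j) ∧
      ∑ j ∈ Finset.range (segLength z A a), x (a * z ^ j) < l * segLength z A a := by
  obtain ⟨h0, h1⟩ := segLength_spec hz hA a
  constructor
  · refine Finset.sum_pos' (fun _ _ => Nat.zero_le _) ⟨0, Finset.mem_range.2 h0, ?_⟩
    rw [← hcut] at ha
    simpa using ha.2
  · have : ∑ j ∈ Finset.range (segLength z A a), x (a * z ^ j) <
        ∑ j ∈ Finset.range (segLength z A a), l := by
      refine Finset.sum_lt_sum (fun _ _ => hx _)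
        ⟨segLength z A a - 1, Finset.mem_range.2 (by omega), ?_⟩
      have h2 : a * z ^ segLength z A a ∈ cutSet z l x := by rwa [hcut]
      obtain ⟨L, hL⟩ := Nat.exists_eq_succ_of_ne_zero h0.ne'
      rw [hL] at h2 ⊢
      have h3 := h2.1
      rwa [pow_succ, ← mul_assoc, mul_inv_cancel_right] at h3
    simpa [mul_comm] using this


end Finite

theorem segWord_mono {s s' : G → ℕ} (h : s ≤ s') : segWord z A l s ≤ segWord z A l s' :=
  fun _ => min_le_min_left _ (Nat.sub_le_sub_right (h _) _)

theorem cutSet_translate (x : G → ℕ) (g : G) :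
    cutSet z l (fun i => x (g * i)) = {i | g * i ∈ cutSet z l x} := by
  ext i
  simp [cutSet, mul_assoc]

theorem backDist_translate {g : G} (hg : ∀ i, i ∈ A ↔ g * i ∈ A) (i : G) :
    backDist z A (g * i) = backDist z A i := by
  simp only [backDist, mul_assoc, ← hg]

theorem segLength_translate {g : G} (hg : ∀ i, i ∈ A ↔ g * i ∈ A) (a : G) :
    segLength z A (g * a) = segLength z A a := by
  simp only [segLength, mul_assoc, ← hg]

theorem segStart_translate {g : G} (hg : ∀ i, i ∈ A ↔ g * i ∈ A) (i : G) :
    segStart z A (g * i) = g * segStart z A i := by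
  rw [segStart, backDist_translate hg, mul_assoc, segStart]

end Cut

/-! ### Boxes with a cyclic group acting freely on the coordinates -/

/-- Every finite set of coordinates on which `G` acts freely, with side lengths constant on the
orbits, gives a box that has a symmetric chain decomposition modulo `G`. -/
def FreeBoxesHaveSCD (G : Type) [Group G] : Prop :=
  ∀ (I : Type) [Fintype I] [MulAction G I], (∀ (g : G) (i : I), g • i = i → g = 1) →
    ∀ k : I → ℕ, (∀ (g : G) i, k (g • i) = k i) → BoxHasSCD G k

/-- The stabilizer of a subset acts on that subset. -/
instance labelStabilizer.instMulAction {G I : Type} [Group G] [MulAction G I] (w : I → Prop) :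
    MulAction (labelStabilizer G w) {i // w i} where
  smul g i := ⟨g.1 • i.1, (g.2 i.1).mp i.2⟩
  one_smul i := Subtype.ext (one_smul G i.1)
  mul_smul g h i := Subtype.ext (mul_smul g.1 h.1 i.1)

section Word

variable {G : Type} [Group G] {z : G} {l : ℕ}

theorem segWord_le (A : Set G) (s : G → ℕ) : segWord z A l s ≤ fun _ => l :=
  fun _ => min_le_left _ _

theorem cutSet_eq_of_smul {x y : G → ℕ} {g : G} (h : ∀ i, x i = y (g • i)) :
    cutSet z l x = {i | g * i ∈ cutSet z l y} := by
  rw [← cutSet_translate]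
  exact congrArg _ (funext h)

variable [Fintype G]

theorem segWord_congr {A : Set G} (hz : ∀ g : G, g ∈ Subgroup.zpowers z) (hA : A.Nonempty)
    {s s' : G → ℕ} (h : ∀ a ∈ A, s a = s' a) : segWord z A l s = segWord z A l s' := by
  funext i
  rw [segWord, segWord, h _ (segStart_mem hz hA i)]

theorem sum_eq_of_smul {x y : G → ℕ} {g : G} (h : ∀ i, x i = y (g • i)) :
    ∑ i, x i = ∑ i, y i := by
  rw [← Equiv.sum_comp (Equiv.mulLeft g) y]
  exact Finset.sum_congr rfl fun i _ => h i

/-- The words with at most one cut form, up to rotation, the single chain of the words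
`l, …, l, c, 0, …, 0`. -/
theorem hasSCD_of_cutSet_subsingleton (hz : ∀ g : G, g ∈ Subgroup.zpowers z)
    (p : Set.Iic (fun _ : G => l) → Prop) (hp : ∀ x, p x ↔ (cutSet z l x.1).Subsingleton) :
    HasSCD ((boxSetoid G (fun _ : G => l)).comap (Subtype.val : {x // p x} → _))
      (fun x => ∑ i, (x.1.1 i : ℤ)) (∑ _i : G, (l : ℤ)) := by
  have h1 : ({1} : Set G).Nonempty := Set.singleton_nonempty 1
  have hlen : segLength z {1} (1 : G) = Fintype.card G := by
    simpa using sum_segLength hz h1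
  have hN : (∑ _i : G, (l : ℤ)) = ((l * Fintype.card G : ℕ) : ℤ) := by
    simp [mul_comm]
  rw [hN]
  refine HasSCD.of_chain (l * Fintype.card G)
    (fun s => ⟨⟨segWord z {1} l fun _ => s, segWord_le _ _⟩, (hp _).2 <|
      Set.subsingleton_singleton.anti (cutSet_segWord_subset hz h1 fun _ => s)⟩) ?_ ?_ ?_ ?_
  · rintro x y ⟨g, hg⟩
    exact_mod_cast sum_eq_of_smul hg
  · rintro ⟨⟨x, hx⟩, hpx⟩
    obtain ⟨c, hc⟩ : ∃ c, cutSet z l x ⊆ {c} := by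
      rcases ((hp _).1 hpx).eq_empty_or_singleton with h | ⟨c, h⟩
      · exact ⟨1, by rw [h]; exact Set.empty_subset _⟩
      · exact ⟨c, h.le⟩
    have hcut : cutSet z l (fun i => x (c * i)) ⊆ {1} := by
      rw [cutSet_translate]
      intro i hi
      simpa using hc hi
    have hsum := sum_eq_sum_segment hz h1 (fun i => x (c * i))
    rw [sum_eq_of_smul (x := fun i => x (c * i)) (y := x) (g := c) fun _ => rfl] at hsum
    refine ⟨∑ i, x i, ?_, c, fun i => ?_⟩
    · calc ∑ i, x i ≤ ∑ _i : G, l := Finset.sum_le_sum fun i _ => hx i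
        _ = l * Fintype.card G := by simp [mul_comm]
    · have := eq_segWord hz h1 (fun i => hx (c * i)) hcut i
      change segWord z {1} l (fun _ => ∑ i, x i) i = x (c * i)
      rw [this]
      refine congrFun (segWord_congr hz h1 ?_) i
      rintro a rfl
      simpa using hsum
  · intro s _
    exact segWord_mono fun _ => s.le_succ
  · intro s hs
    have := sum_segWord hz h1 (l := l) (s := fun _ => s) (by
      rintro a rfl
      rwa [hlen])
    rw [Fintype.sum_unique (ι := ({1} : Set G))] at this
    exact_mod_cast this

/-- The words cut everywhere are those with letters in `[1, l - 1]`. -/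
theorem hasSCD_of_cutSet_eq_univ (hl : 2 ≤ l) (ih : BoxHasSCD G (fun _ : G => l - 2))
    (p : Set.Iic (fun _ : G => l) → Prop) (hp : ∀ x, p x ↔ cutSet z l x.1 = Set.univ) :
    HasSCD ((boxSetoid G (fun _ : G => l)).comap (Subtype.val : {x // p x} → _))
      (fun x => ∑ i, (x.1.1 i : ℤ)) (∑ _i : G, (l : ℤ)) := by
  refine ih.transfer (fun y => ⟨⟨fun i => y.1 i + 1, fun i => ?_⟩, (hp _).2 ?_⟩)
    (Fintype.card G) ?_ ?_ ?_ ?_ ?_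
  · have : y.1 i ≤ l - 2 := y.2 i
    change y.1 i + 1 ≤ l
    omega
  · refine Set.eq_univ_of_forall fun i => ⟨?_, Nat.succ_pos _⟩
    have : y.1 (i * z⁻¹) ≤ l - 2 := y.2 _
    change y.1 (i * z⁻¹) + 1 < l
    omega
  · intro y y' h i
    exact Nat.succ_le_succ (h i)
  · intro y
    simp [Finset.sum_add_distrib]
  · rw [Finset.sum_const, Finset.sum_const]
    push_cast [hl]
    simp
    ring
  · intro y y'
    exact exists_congr fun g => forall_congr' fun i => Nat.succ_inj
  · rintro ⟨⟨x, hx⟩, hpx⟩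
    have hcut : cutSet z l x = Set.univ := (hp _).1 hpx
    have h0 : ∀ i, 0 < x i := fun i => (hcut.symm.le (Set.mem_univ i)).2
    have h1 : ∀ i, x i < l := fun i => by
      have := (hcut.symm.le (Set.mem_univ (i * z))).1
      rwa [mul_inv_cancel_right] at this
    refine ⟨⟨fun i => x i - 1, fun i => ?_⟩, 1, fun i => ?_⟩
    · have := h1 i
      change x i - 1 ≤ l - 2
      omega
    · have := h0 i
      change x i - 1 + 1 = x (1 • i)
      rw [one_smul]
      omega

/-- The words whose cut set is a translate of `A` correspond, through their sums over the segments,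
to the points of a box with one coordinate for each element of `A`. -/
theorem hasSCD_of_cutSet_translate (hz : ∀ g : G, g ∈ Subgroup.zpowers z) {A : Set G}
    (hA : A.Nonempty) (ih : FreeBoxesHaveSCD (labelStabilizer G (· ∈ A)))
    (p : Set.Iic (fun _ : G => l) → Prop)
    (hp : ∀ x, p x ↔ ∃ g : G, ∀ i, i ∈ A ↔ g * i ∈ cutSet z l x.1)
    (hne : ∃ x, p x) :
    HasSCD ((boxSetoid G (fun _ : G => l)).comap (Subtype.val : {x // p x} → _))
      (fun x => ∑ i, (x.1.1 i : ℤ)) (∑ _i : G, (l : ℤ)) := by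
  classical
  -- a rotation of any word of the family has cut set exactly `A`
  have hrot : ∀ x : Set.Iic (fun _ : G => l), p x → ∃ g : G,
      cutSet z l (fun i => x.1 (g * i)) = A := by
    intro x hx
    obtain ⟨g, hg⟩ := (hp x).1 hx
    refine ⟨g, ?_⟩
    rw [cutSet_translate]
    ext i
    exact (hg i).symm
  have hlen : ∀ a ∈ A, 2 ≤ l * segLength z A a := by
    obtain ⟨x, hx⟩ := hne
    obtain ⟨g, hg⟩ := hrot x hx
    intro a ha
    have := segSum_bounds hz hA (fun i => x.2 (g * i)) hg ha
    omega
  let k : {a // a ∈ A} → ℕ := fun a => l * segLength z A a.1 - 2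
  let s : Set.Iic k → G → ℕ := fun y a => if h : a ∈ A then y.1 ⟨a, h⟩ + 1 else 0
  have hs : ∀ y a (h : a ∈ A), s y a = y.1 ⟨a, h⟩ + 1 := fun y a h => dif_pos h
  have hs0 : ∀ y, ∀ a ∈ A, 0 < s y a := fun y a h => by rw [hs y a h]; omega
  have hs1 : ∀ y, ∀ a ∈ A, s y a < l * segLength z A a := fun y a h => by
    have h1 : y.1 ⟨a, h⟩ ≤ l * segLength z A a - 2 := y.2 ⟨a, h⟩
    have := hlen a h
    rw [hs y a h]
    omega
  have hcut : ∀ y, cutSet z l (segWord z A l (s y)) = A := fun y =>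
    cutSet_segWord hz hA (hs0 y) (hs1 y)
  have hbox : BoxHasSCD (labelStabilizer G (· ∈ A)) k := by
    refine ih {a // a ∈ A} (fun g a h => ?_) k fun g a => ?_
    · have h1 : g.1 * a.1 = a.1 := congrArg Subtype.val h
      exact Subtype.ext (mul_eq_right.1 h1)
    · have := segLength_translate (z := z) (A := A) (g := g.1) (fun i => (g.2 i).to_iff) a.1
      change l * segLength z A (g.1 * a.1) - 2 = _
      rw [this]
  refine hbox.transfer (fun y => ⟨⟨segWord z A l (s y), segWord_le _ _⟩, (hp _).2
    ⟨1, fun i => by rw [one_mul, hcut]⟩⟩) (Fintype.card {a // a ∈ A}) ?_ ?_ ?_ ?_ ?_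
  · intro y y' h
    refine segWord_mono fun a => ?_
    by_cases ha : a ∈ A
    · rw [hs _ _ ha, hs _ _ ha]
      exact Nat.succ_le_succ (h ⟨a, ha⟩)
    · exact (dif_neg ha).trans_le (Nat.zero_le _)
  · intro y
    have h1 := sum_segWord hz hA (fun a ha => (hs1 y a ha).le)
    have h2 : ∑ a : A, s y a = ∑ a : {a // a ∈ A}, (y.1 a + 1) :=
      Finset.sum_congr rfl fun a _ => hs y a.1 a.2
    rw [h2, Finset.sum_add_distrib] at h1
    simp only [Finset.sum_const, Finset.card_univ, smul_eq_mul, mul_one] at h1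
    exact_mod_cast h1
  · have h1 := sum_segLength hz hA
    have h2 : ∑ a : {a // a ∈ A}, (k a + 2) = ∑ a : A, l * segLength z A a :=
      Finset.sum_congr rfl fun a _ => Nat.sub_add_cancel (hlen a.1 a.2)
    rw [← Finset.mul_sum, h1, Finset.sum_add_distrib] at h2
    simp only [Finset.sum_const, Finset.card_univ, smul_eq_mul] at h2
    simp only [Finset.sum_const, Finset.card_univ, nsmul_eq_mul]
    have h3 : (∑ a, (k a : ℤ)) + Fintype.card {a // a ∈ A} * 2 = l * Fintype.card G := by
      exact_mod_cast h2
    linarith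
  · intro y y'
    constructor
    · rintro ⟨g, hg⟩
      have hg : ∀ i, segWord z A l (s y) i = segWord z A l (s y') (g • i) := hg
      have hgA : ∀ i, i ∈ A ↔ g * i ∈ A := by
        intro i
        have := cutSet_eq_of_smul (z := z) (l := l) hg
        rw [hcut, hcut] at this
        exact Set.ext_iff.1 this i
      refine ⟨⟨g, fun i => propext (hgA i)⟩, fun a => ?_⟩
      have h1 := sum_segWord_segment a.2 (hs1 y a.1 a.2).le
      have ha' := (hgA a.1).1 a.2
      have h2 := sum_segWord_segment ha' (hs1 y' _ ha').le
      rw [segLength_translate hgA] at h2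
      have h3 : s y a.1 = s y' (g * a.1) := by
        rw [← h1, ← h2]
        refine Finset.sum_congr rfl fun j _ => ?_
        rw [hg, smul_eq_mul, mul_assoc]
      rw [hs _ _ a.2, hs _ _ ha'] at h3
      exact Nat.succ_injective h3
    · rintro ⟨⟨g, hg⟩, h⟩
      have hgA : ∀ i, i ∈ A ↔ g * i ∈ A := fun i => (hg i).to_iff
      refine ⟨g, fun i => ?_⟩
      change segWord z A l (s y) i = segWord z A l (s y') (g * i)
      have hmem := segStart_mem hz hA i
      rw [segWord, segWord, backDist_translate hgA, segStart_translate hgA, hs _ _ hmem,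
        hs _ _ ((hgA _).1 hmem)]
      congr 3
      exact h ⟨_, hmem⟩
  · rintro ⟨x, hx⟩
    obtain ⟨g, hg⟩ := hrot x hx
    have hle : ∀ i, x.1 (g * i) ≤ l := fun i => x.2 _
    refine ⟨⟨fun a => ∑ j ∈ Finset.range (segLength z A a.1), x.1 (g * (a.1 * z ^ j)) - 1,
      fun a => ?_⟩, g, fun i => ?_⟩
    · have := (segSum_bounds hz hA hle hg a.2).2
      change _ - 1 ≤ l * segLength z A a.1 - 2
      omega
    · have := eq_segWord hz hA hle hg.le i
      refine Eq.trans (congrFun (segWord_congr hz hA fun a ha => ?_) i) this.symm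
      rw [hs _ _ ha]
      have := (segSum_bounds hz hA hle hg ha).1
      exact Nat.sub_add_cancel this

/-- Words over `[0, l]` on a cycle, up to rotation, have a symmetric chain decomposition, provided
that the proper subgroups of the rotation group are already understood. -/
theorem boxHasSCD_word (hz : ∀ g : G, g ∈ Subgroup.zpowers z)
    (ih : ∀ H : Subgroup G, H ≠ ⊤ → FreeBoxesHaveSCD H) (l : ℕ) :
    BoxHasSCD G (fun _ : G => l) := by
  classical
  induction l using Nat.strong_induction_on with
  | _ l ihl =>
  let S : Setoid (G → Prop) := orbitSetoid G G (⊥ : Setoid Prop)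
  let π : Set.Iic (fun _ : G => l) → Option (Quotient S) := fun x =>
    if (cutSet z l x.1).Subsingleton then none
    else some (Quotient.mk S fun i => i ∈ cutSet z l x.1)
  refine HasSCD.of_fibers π ?_ ?_
  · rintro x y ⟨g, hg⟩
    have hxy := cutSet_eq_of_smul (z := z) (l := l) hg
    have hsub : (cutSet z l x.1).Subsingleton ↔ (cutSet z l y.1).Subsingleton := by
      rw [hxy]
      constructor
      · intro h a ha b hb
        have := h (x := g⁻¹ * a) (by simpa using ha) (y := g⁻¹ * b) (by simpa using hb)
        exact mul_left_cancel this
      · intro h a ha b hb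
        exact mul_left_cancel (h ha hb)
    have hq : Quotient.mk S (fun i => i ∈ cutSet z l x.1) =
        Quotient.mk S (fun i => i ∈ cutSet z l y.1) :=
      Quotient.sound ⟨g, fun i => by rw [hxy]; rfl⟩
    simp only [π, hsub, hq]
  · rintro (_ | q)
    · refine hasSCD_of_cutSet_subsingleton hz _ fun x => ?_
      by_cases h : (cutSet z l x.1).Subsingleton <;> simp [π, h]
    by_cases hne : ∃ x, π x = some q
    swap
    · have : IsEmpty {x // π x = some q} := ⟨fun x => hne ⟨x.1, x.2⟩⟩
      exact HasSCD.of_isEmpty _ _ _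
    let A : Set G := {i | q.out i}
    have hq : Quotient.mk S (fun i => i ∈ A) = q := q.out_eq
    have hπ : ∀ x, π x = some q ↔ ¬ (cutSet z l x.1).Subsingleton ∧
        ∃ g : G, ∀ i, i ∈ A ↔ g * i ∈ cutSet z l x.1 := by
      intro x
      by_cases h : (cutSet z l x.1).Subsingleton
      · simp [π, h]
      · simp only [π, h, if_false, not_false_eq_true, true_and, Option.some_inj]
        rw [← hq, eq_comm, Quotient.eq (r := S)]
        exact exists_congr fun g => forall_congr' fun i => eq_iff_iff
    have hAsub : ¬ A.Subsingleton := by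
      obtain ⟨x, hx⟩ := hne
      obtain ⟨h1, g, hg⟩ := (hπ x).1 hx
      intro hA
      refine h1 fun a ha b hb => ?_
      exact mul_left_cancel (hA ((hg (g⁻¹ * a)).2 (by simpa using ha))
        ((hg (g⁻¹ * b)).2 (by simpa using hb)))
    have hπ' : ∀ x, π x = some q ↔ ∃ g : G, ∀ i, i ∈ A ↔ g * i ∈ cutSet z l x.1 := by
      refine fun x => (hπ x).trans (and_iff_right_of_imp ?_)
      rintro ⟨g, hg⟩ h
      exact hAsub fun a ha b hb => mul_left_cancel (h ((hg a).1 ha) ((hg b).1 hb))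
    have hA : A.Nonempty := by
      by_contra h
      rw [Set.not_nonempty_iff_eq_empty] at h
      exact hAsub (h ▸ Set.subsingleton_empty)
    by_cases hU : A = Set.univ
    · have hp : ∀ x, π x = some q ↔ cutSet z l x.1 = Set.univ := by
        refine fun x => (hπ' x).trans ?_
        rw [hU, Set.eq_univ_iff_forall]
        constructor
        · rintro ⟨g, hg⟩ i
          simpa using (hg (g⁻¹ * i)).1 trivial
        · exact fun h => ⟨1, fun i => iff_of_true trivial (h _)⟩
      have hl : 2 ≤ l := by
        obtain ⟨x, hx⟩ := hne
        have h1 := ((hp x).1 hx).symm.le (Set.mem_univ (1 : G))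
        have h2 := ((hp x).1 hx).symm.le (Set.mem_univ ((1 : G) * z⁻¹))
        have := h1.1
        have := h2.2
        omega
      exact hasSCD_of_cutSet_eq_univ hl (ihl _ (by omega)) _ hp
    · refine hasSCD_of_cutSet_translate hz hA (ih _ fun htop => hU ?_) _ hπ' hne
      obtain ⟨a, ha⟩ := hA
      refine Set.eq_univ_of_forall fun i => ?_
      have : i * a⁻¹ ∈ labelStabilizer G (· ∈ A) := htop ▸ Subgroup.mem_top _
      have := (this a).mp ha
      simpa using this

end Word

theorem hasSCD_box {I : Type} [Fintype I] (k : I → ℕ) :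
    HasSCD (⊥ : Setoid (Set.Iic k)) (fun x => ∑ i, (x.1 i : ℤ)) (∑ i, (k i : ℤ)) := by
  have h : ∀ i, HasSCD (⊥ : Setoid (Set.Iic (k i))) (fun x => (x.1 : ℤ)) (k i : ℤ) := by
    intro i
    refine HasSCD.of_chain (k i) (fun j => ⟨min j (k i), Set.mem_Iic.2 (min_le_right _ _)⟩)
      ?_ ?_ ?_ ?_
    · rintro x y rfl
      rfl
    · exact fun x => ⟨x.1, x.2, Subtype.ext (min_eq_left x.2)⟩
    · exact fun j _ => Subtype.mk_le_mk.2 (min_le_min_right _ j.le_succ)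
    · intro j hj
      simp [hj]
  refine (HasSCD.pi I _ _ _ _ h).transfer (fun x => ⟨fun i => (x i).1, fun i => (x i).2⟩) 0
    (fun x y hxy i => hxy i) (fun x => by simp) (by simp) ?_ ?_
  · intro x y
    constructor
    · intro hxy i
      exact Subtype.ext (congrFun (congrArg Subtype.val hxy) i)
    · intro hxy
      exact Subtype.ext (funext fun i => congrArg Subtype.val (hxy i))
  · exact fun y => ⟨fun i => ⟨y.1 i, y.2 i⟩, rfl⟩

/-- A free action on `I` identifies `I` with `J × G`, where `J` is the set of orbits, and the box
with the words on `G` whose letters are points of a box on `J`. Labelling the letters by the chains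
of a decomposition of that box leaves either a proper subgroup of `G`, or words over one chain. -/
theorem freeBoxesHaveSCD_of_isCyclic : ∀ (n : ℕ) (G : Type) [Group G] [Finite G] [IsCyclic G],
    Nat.card G = n → FreeBoxesHaveSCD G := by
  intro n
  induction n using Nat.strong_induction_on with
  | _ n ih =>
  intro G _ _ _ hn I _ _ hfree k hk
  classical
  have : Fintype G := Fintype.ofFinite G
  have hlt : ∀ H : Subgroup G, H ≠ ⊤ → FreeBoxesHaveSCD H := by
    intro H hH
    refine ih (Nat.card H) ?_ H rfl
    rw [← hn]
    refine lt_of_le_of_ne (Subgroup.card_le_card_group H) fun h => hH ?_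
    exact Subgroup.eq_top_of_card_eq H h
  obtain ⟨z, hz⟩ := IsCyclic.exists_generator (α := G)
  let J := MulAction.orbitRel.Quotient G I
  have : Fintype J := Fintype.ofFinite J
  let r : J → I := fun q => Quotient.out q
  have hr : ∀ i : I, ∃ q : J, ∃ g : G, g • r q = i := by
    intro i
    have : r (Quotient.mk _ i) ∈ MulAction.orbit G i :=
      Quotient.mk_out (s := MulAction.orbitRel G I) i
    obtain ⟨g, hg⟩ := this
    exact ⟨Quotient.mk _ i, g⁻¹, by rw [← hg]; exact inv_smul_smul g i⟩
  have hr' : ∀ (q q' : J) (g g' : G), g • r q = g' • r q' → q = q' ∧ g = g' := by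
    intro q q' g g' h
    have hq : q = q' := by
      rw [← Quotient.out_eq q, ← Quotient.out_eq q']
      refine Quotient.sound (s := MulAction.orbitRel G I) ⟨g⁻¹ * g', ?_⟩
      change (g⁻¹ * g') • r q' = r q
      rw [mul_smul, ← h, inv_smul_smul]
    subst hq
    refine ⟨rfl, ?_⟩
    have := hfree (g'⁻¹ * g) (r q) (by rw [mul_smul, h, inv_smul_smul])
    rwa [inv_mul_eq_one, eq_comm] at this
  choose cls off hoff using hr
  have hcls : ∀ (g : G) q, cls (g • r q) = q ∧ off (g • r q) = g := fun g q =>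
    hr' _ _ _ _ (hoff _)
  have hsmul : ∀ (g : G) i, cls (g • i) = cls i ∧ off (g • i) = g * off i := by
    intro g i
    have := hcls (g * off i) (cls i)
    rwa [mul_smul, hoff] at this
  have hkr : ∀ i, k i = k (r (cls i)) := fun i => by
    conv_lhs => rw [← hoff i]
    exact hk _ _
  have hsum : ∀ f : I → ℤ, ∑ i, f i = ∑ g : G, ∑ q : J, f (g • r q) := by
    intro f
    rw [← Finset.sum_product']
    refine Finset.sum_bij' (fun i _ => (off i, cls i)) (fun p _ => p.1 • r p.2) (by simp) (by simp)
      (fun i _ => hoff i) (fun p _ => ?_) (fun i _ => by rw [hoff])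
    exact Prod.ext (hcls _ _).2 (hcls _ _).1
  have hwords : HasSCD (orbitSetoid G G (⊥ : Setoid (Set.Iic fun q : J => k (r q))))
      (fun x => ∑ g, ∑ q, ((x g).1 q : ℤ)) (∑ _g : G, ∑ q : J, (k (r q) : ℤ)) := by
    refine HasSCD.fun_of_box (hasSCD_box fun q : J => k (r q)) fun W w m => ?_
    by_cases htop : labelStabilizer G w = ⊤
    · have hw : ∀ g, w g = w 1 := fun g => by
        have : g ∈ labelStabilizer G w := htop ▸ Subgroup.mem_top _
        simpa using (this 1).symm
      have hword := boxHasSCD_word hz hlt (m (w 1))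
      have hconst : (fun g => m (w g)) = fun _ : G => m (w 1) := funext fun g => by rw [hw]
      rw [hconst]
      refine hword.transfer id 0 monotone_id (fun _ => (add_zero _).symm) (by simp)
        (fun x y => ?_) fun y => ⟨y, (boxSetoid (labelStabilizer G w) _).iseqv.refl y⟩
      constructor
      · rintro ⟨g, hg⟩
        exact ⟨g.1, hg⟩
      · rintro ⟨g, hg⟩
        exact ⟨⟨g, htop ▸ Subgroup.mem_top _⟩, hg⟩
    · refine hlt _ htop G (fun g i h => ?_) _ fun g i => ?_
      · exact Subtype.ext (mul_eq_right.1 h)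
      · rw [g.2 i]
        rfl
  refine hwords.transfer (fun x => ⟨fun i => (x (off i)).1 (cls i), fun i => ?_⟩) 0
    ?_ ?_ ?_ ?_ ?_
  · rw [hkr]
    exact (x (off i)).2 (cls i)
  · exact fun x y hxy i => hxy (off i) (cls i)
  · intro x
    rw [hsum, add_zero]
    exact Finset.sum_congr rfl fun g _ => Finset.sum_congr rfl fun q _ => by
      simp only [hcls]
  · rw [hsum, mul_zero, add_zero]
    exact Finset.sum_congr rfl fun g _ => Finset.sum_congr rfl fun q _ => by rw [hk]
  · intro x y
    constructor
    · rintro ⟨g, hg⟩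
      refine ⟨g, fun h => Subtype.ext (funext fun q => ?_)⟩
      have : (x (off (h • r q))).1 (cls (h • r q)) =
          (y (off (g • h • r q))).1 (cls (g • h • r q)) := hg (h • r q)
      rwa [(hcls h q).1, (hcls h q).2, (hsmul g _).1, (hsmul g _).2, (hcls h q).1,
        (hcls h q).2] at this
    · rintro ⟨g, hg⟩
      refine ⟨g, fun i => ?_⟩
      change (x (off i)).1 (cls i) = (y (off (g • i))).1 (cls (g • i))
      rw [(hsmul g i).1, (hsmul g i).2]
      exact congrFun (congrArg Subtype.val (hg (off i))) (cls i)
  · intro y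
    refine ⟨fun g => ⟨fun q => y.1 (g • r q), fun q => ?_⟩, 1, fun i => ?_⟩
    · change y.1 (g • r q) ≤ k (r q)
      rw [← hk g]
      exact y.2 _
    · change y.1 (off i • r (cls i)) = y.1 (1 • i)
      rw [hoff, one_smul]

/-- If `P` has a symmetric chain decomposition, then so has `I → P` modulo a finite cyclic group
acting freely on `I`. -/
theorem HasSCD.fun_of_isCyclic {G I P : Type} [Group G] [Finite G] [IsCyclic G] [MulAction G I]
    [Fintype I] (hfree : ∀ (g : G) (i : I), g • i = i → g = 1) [Preorder P] {E : Setoid P}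
    {ρ : P → ℤ} {N : ℤ} (hP : HasSCD E ρ N) :
    HasSCD (orbitSetoid G I E) (fun x => ∑ i, ρ (x i)) (∑ _i : I, N) := by
  refine hP.fun_of_box fun W w m => freeBoxesHaveSCD_of_isCyclic _ _ rfl I ?_ _ ?_
  · exact fun g i h => Subtype.ext (hfree g.1 i h)
  · intro g i
    rw [g.2 i]
    rfl

/-! ### Groups generated by powers of disjoint cycles -/

section Perm

open Equiv

variable {β J : Type} {cls : β → J} {φ : J → Perm β}

theorem cls_zpow_apply (hφ : ∀ j b, cls (φ j b) = cls b) (j : J) (n : ℤ) (b : β) :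
    cls ((φ j ^ n) b) = cls b := by
  have hpow : ∀ (n : ℕ) b, cls ((φ j ^ n) b) = cls b := by
    intro n
    induction n with
    | zero => exact fun _ => rfl
    | succ n ih => exact fun b => by rw [pow_succ, Perm.mul_apply, ih, hφ]
  obtain ⟨n, rfl | rfl⟩ := n.eq_nat_or_neg
  · rw [zpow_natCast, hpow]
  · rw [zpow_neg, zpow_natCast, ← hpow n, ← Perm.mul_apply, mul_inv_cancel, Perm.one_apply]

/-- The elements of the group generated by the `φ j` act on the classes by independent powers of the
`φ j`; `exists_mem_closure_of_zpow` says that all choices of the powers occur. -/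
theorem exists_zpow_of_mem_closure (hφ : ∀ j b, cls (φ j b) = cls b)
    (hfix : ∀ j b, cls b ≠ j → φ j b = b) {τ : Perm β}
    (hτ : τ ∈ Subgroup.closure (Set.range φ)) :
    ∃ n : J → ℤ, ∀ b, τ b = (φ (cls b) ^ n (cls b)) b := by
  classical
  induction hτ using Subgroup.closure_induction with
  | mem x hx =>
    obtain ⟨j, rfl⟩ := hx
    refine ⟨fun i => if i = j then 1 else 0, fun b => ?_⟩
    by_cases h : cls b = j
    · simp [h]
    · simp [h, hfix j b h]
  | one => exact ⟨0, fun b => by simp⟩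
  | mul x y _ _ ihx ihy =>
    obtain ⟨n, hn⟩ := ihx
    obtain ⟨n', hn'⟩ := ihy
    refine ⟨n + n', fun b => ?_⟩
    rw [Perm.mul_apply, hn, hn', cls_zpow_apply hφ, ← Perm.mul_apply, ← zpow_add]
    rfl
  | inv x _ ih =>
    obtain ⟨n, hn⟩ := ih
    refine ⟨-n, fun b => ?_⟩
    rw [Perm.inv_eq_iff_eq, hn, cls_zpow_apply hφ, ← Perm.mul_apply, ← zpow_add]
    simp

theorem exists_mem_closure_of_zpow [Finite J] (hφ : ∀ j b, cls (φ j b) = cls b)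
    (hfix : ∀ j b, cls b ≠ j → φ j b = b) (n : J → ℤ) :
    ∃ τ ∈ Subgroup.closure (Set.range φ), ∀ b, τ b = (φ (cls b) ^ n (cls b)) b := by
  classical
  have := Fintype.ofFinite J
  have key : ∀ s : Finset J, ∃ τ ∈ Subgroup.closure (Set.range φ),
      ∀ b, τ b = if cls b ∈ s then (φ (cls b) ^ n (cls b)) b else b := by
    intro s
    induction s using Finset.induction_on with
    | empty => exact ⟨1, Subgroup.one_mem _, fun b => by simp⟩
    | insert j s hj ih =>
      obtain ⟨τ, hτ, h⟩ := ih
      refine ⟨τ * φ j ^ n j, Subgroup.mul_mem _ hτ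
        (Subgroup.zpow_mem _ (Subgroup.subset_closure (Set.mem_range_self j)) _), fun b => ?_⟩
      rw [Perm.mul_apply, h, cls_zpow_apply hφ]
      by_cases hb : cls b = j
      · subst hb
        simp [hj]
      · have : (φ j ^ n j) b = b := Perm.zpow_apply_eq_self_of_apply_eq_self (hfix j b hb) _
        simp [hb, this]
  obtain ⟨τ, hτ, h⟩ := key Finset.univ
  exact ⟨τ, hτ, fun b => by simpa using h b⟩

/-- If `β` splits into classes such that each `φ j` acts on the `j`-th class, as the generator of a
group acting freely there, and fixes all other points, then `β → P` modulo `⟨φ j⟩` is a product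
over the classes of quotients by free cyclic actions. -/
theorem HasSCD.fun_of_classes [Fintype β] [Fintype J]
    (hφ : ∀ j b, cls (φ j b) = cls b) (hfix : ∀ j b, cls b ≠ j → φ j b = b)
    (hfree : ∀ (n : ℤ) b, (φ (cls b) ^ n) b = b → φ (cls b) ^ n = 1)
    {P : Type} [Preorder P] {E : Setoid P} {ρ : P → ℤ} {N : ℤ} (hP : HasSCD E ρ N) :
    HasSCD (orbitSetoid (Subgroup.closure (Set.range φ)) β E) (fun x => ∑ i, ρ (x i))
      (∑ _i : β, N) := by
  classical
  let ψ : ∀ j, Perm {b // cls b = j} := fun j =>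
    (φ j).subtypePerm fun b => by rw [hφ]
  have hψ : ∀ j (n : ℤ) (b : {b // cls b = j}), ((ψ j ^ n) b).1 = (φ j ^ n) b.1 := by
    intro j n b
    rw [Perm.subtypePerm_zpow]
    rfl
  have h : ∀ j, HasSCD (orbitSetoid (Subgroup.zpowers (ψ j)) {b // cls b = j} E)
      (fun x => ∑ i, ρ (x i)) (∑ _i : {b // cls b = j}, N) := by
    refine fun j => hP.fun_of_isCyclic ?_
    rintro ⟨_, n, rfl⟩ ⟨b, rfl⟩ hb
    have hb' : (φ (cls b) ^ n) b = b := by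
      rw [← hψ _ n ⟨b, rfl⟩]
      exact congrArg Subtype.val hb
    refine Subtype.ext (Perm.ext fun c => Subtype.ext ?_)
    have := hψ _ n c
    rw [hfree n b hb'] at this
    exact this
  have hsum : ∀ f : β → ℤ, ∑ j, ∑ b : {b // cls b = j}, f b.1 = ∑ b, f b := fun f =>
    Fintype.sum_fiberwise cls f
  refine (HasSCD.pi J _ _ _ _ h).transfer (fun x b => x (cls b) ⟨b, rfl⟩) 0
    (fun x y hxy b => hxy _ _) ?_ ?_ ?_ ?_
  · intro x
    rw [← hsum, add_zero]
    refine Finset.sum_congr rfl fun j _ => Finset.sum_congr rfl ?_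
    rintro ⟨b, rfl⟩ _
    rfl
  · rw [← hsum, mul_zero, add_zero]
  · intro x y
    constructor
    · rintro ⟨⟨τ, hτ⟩, h⟩ j
      obtain ⟨n, hn⟩ := exists_zpow_of_mem_closure hφ hfix hτ
      refine ⟨⟨ψ j ^ n j, n j, rfl⟩, ?_⟩
      rintro ⟨b, rfl⟩
      have hb : E (x (cls b) ⟨b, rfl⟩) (y (cls (τ b)) ⟨τ b, rfl⟩) := h b
      have hval : ((ψ (cls b) ^ n (cls b)) ⟨b, rfl⟩).1 = τ b := by rw [hψ, hn]
      have key : ∀ (j : J) (c : {b // cls b = j}), c.1 = τ b → cls b = j →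
          E (y (cls (τ b)) ⟨τ b, rfl⟩) (y j c) := by
        rintro _ ⟨c, rfl⟩ rfl _
        exact E.refl _
      exact E.trans hb (key _ _ hval rfl)
    · intro h
      have h' : ∀ j, ∃ n : ℤ, ∀ b : {b // cls b = j}, E (x j b) (y j ((ψ j ^ n) b)) := by
        intro j
        obtain ⟨⟨_, n, rfl⟩, hn⟩ := h j
        exact ⟨n, hn⟩
      choose n hn using h'
      obtain ⟨τ, hτ, h⟩ := exists_mem_closure_of_zpow hφ hfix n
      refine ⟨⟨τ, hτ⟩, fun b => E.trans (hn (cls b) ⟨b, rfl⟩) ?_⟩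
      have hval : ((ψ (cls b) ^ n (cls b)) ⟨b, rfl⟩).1 = τ b := by rw [hψ, h]
      have key : ∀ (j : J) (c : {b // cls b = j}), c.1 = τ b →
          E (y j c) (y (cls (τ b)) ⟨τ b, rfl⟩) := by
        rintro _ ⟨c, rfl⟩ rfl
        exact E.refl _
      exact key _ _ hval
  · intro y
    exact ⟨fun j b => y b.1, Setoid.refl' _ _⟩

theorem HasSCD.fun_of_disjoint_cycles [Fintype β] {T : Subgroup (Perm β)}
    (hT : IsGeneratedByPowersOfDisjointCycles T) {P : Type} [Preorder P] {E : Setoid P}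
    {ρ : P → ℤ} {N : ℤ} (hP : HasSCD E ρ N) :
    HasSCD (orbitSetoid T β E) (fun x => ∑ i, ρ (x i)) (∑ _i : β, N) := by
  classical
  obtain ⟨m, σ, r, hσ, hdis, rfl⟩ := hT
  -- the classes are the supports of the cycles, and the set of the remaining points
  let cls : β → Option (Fin m) := fun b =>
    if h : ∃ i, σ i b ≠ b then some h.choose else none
  let φ : Option (Fin m) → Perm β := fun o => o.elim 1 fun i => σ i ^ r i
  have hcls : ∀ i b, cls b = some i ↔ σ i b ≠ b := by
    intro i b
    have huniq : ∀ i j, σ i b ≠ b → σ j b ≠ b → i = j := fun i j hi hj => by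
      by_contra hij
      exact (hdis i j hij b).elim hi hj
    by_cases h : ∃ i, σ i b ≠ b
    · simp only [cls, h, dif_pos, Option.some_inj]
      exact ⟨fun hi => hi ▸ h.choose_spec, huniq _ _ h.choose_spec⟩
    · simp only [cls, h, dif_neg, not_false_eq_true, reduceCtorEq, false_iff]
      exact fun hi => h ⟨i, hi⟩
  have hfix : ∀ o b, cls b ≠ o → φ o b = b := by
    rintro (_ | i) b hb
    · rfl
    · rw [Ne, hcls, not_not] at hb
      exact Perm.pow_apply_eq_self_of_apply_eq_self hb _
  have hφ : ∀ o b, cls (φ o b) = cls b := by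
    intro o b
    by_cases hb : cls b = o
    · rcases o with _ | i
      · rfl
      · rw [hb, hcls]
        rw [hcls] at hb
        change σ i ((σ i ^ r i) b) ≠ (σ i ^ r i) b
        rw [← Perm.mul_apply, ← pow_succ', pow_succ, Perm.mul_apply]
        exact fun h => hb ((σ i ^ r i).injective h)
    · rw [hfix o b hb]
  have hfree : ∀ (n : ℤ) b, (φ (cls b) ^ n) b = b → φ (cls b) ^ n = 1 := by
    intro n b hb
    rcases h : cls b with _ | i
    · exact one_zpow n
    · rw [h] at hb
      rw [hcls] at h
      have hmem : φ (some i) ^ n ∈ Subgroup.zpowers (σ i) :=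
        Subgroup.zpow_mem _ (Subgroup.pow_mem _ (Subgroup.mem_zpowers _) _) _
      obtain ⟨k, hk⟩ := mem_powers_iff_mem_zpowers.2 hmem
      have hk : σ i ^ k = φ (some i) ^ n := hk
      rw [← hk] at hb ⊢
      exact (hσ i).pow_eq_one_iff.2 ⟨b, h, hb⟩
  have hclosure : Subgroup.closure (Set.range fun i => σ i ^ r i) =
      Subgroup.closure (Set.range φ) := by
    refine le_antisymm (Subgroup.closure_mono ?_) ((Subgroup.closure_le _).2 ?_)
    · rintro _ ⟨i, rfl⟩
      exact ⟨some i, rfl⟩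
    · rintro _ ⟨_ | i, rfl⟩
      · exact Subgroup.one_mem _
      · exact Subgroup.subset_closure ⟨i, rfl⟩
  rw [hclosure]
  exact hP.fun_of_classes hφ hfix hfree

end Perm

/-! ### From decompositions modulo an equivalence relation to symmetric chain orders -/

section Graded

variable {Q : Type} [PartialOrder Q] {r : Q → ℕ} {N : ℕ} {bot top : Q}

theorem height_eq_of_graded (hr : StrictMono r) (hbot : ∀ x, bot ≤ x) (h0 : r bot = 0)
    (hstep : ∀ a b, a < b → ∃ c, a < c ∧ c ≤ b ∧ r c = r a + 1) (x : Q) :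
    Order.height x = r x := by
  apply le_antisymm
  · suffices ∀ n : ℕ, ∀ x, r x ≤ n → Order.height x ≤ n from this _ x le_rfl
    intro n
    induction n with
    | zero =>
      intro x hx
      rw [Order.height_le_coe_iff]
      intro y hy
      have := hr hy
      omega
    | succ n ih =>
      intro x hx
      rw [Order.height_le_coe_iff]
      intro y hy
      have := hr hy
      exact (ih y (by omega)).trans_lt (by exact_mod_cast n.lt_succ_self)
  · have key : ∀ k : ℕ, k ≤ r x → ∃ c ≤ x, r c = k ∧ (k : ℕ∞) ≤ Order.height c := by
      intro k
      induction k with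
      | zero => exact fun _ => ⟨bot, hbot x, h0, by simp⟩
      | succ k ih =>
        intro hk
        obtain ⟨c, hcx, hc, hh⟩ := ih (by omega)
        obtain ⟨d, hcd, hdx, hd⟩ := hstep c x (lt_of_le_of_ne hcx (by rintro rfl; omega))
        refine ⟨d, hdx, by omega, ?_⟩
        push_cast
        exact (add_le_add_left hh 1).trans (Order.height_add_one_le hcd)
    obtain ⟨c, hcx, hc, hh⟩ := key (r x) le_rfl
    rcases hcx.eq_or_lt with rfl | hlt
    · exact hh
    · exact absurd (hr hlt) (by omega)

theorem isRankedPoset_of_graded [Finite Q] (hr : StrictMono r) (hbot : ∀ x, bot ≤ x)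
    (htop : ∀ x, x ≤ top) (h0 : r bot = 0) (hN : r top = N)
    (hstep : ∀ a b, a < b → ∃ c, a < c ∧ c ≤ b ∧ r c = r a + 1) : IsRankedPoset Q := by
  have hle : ∀ {C : Set Q}, IsChain (· ≤ ·) C → ∀ {a b : Q}, a ∈ C → b ∈ C → r a ≤ r b →
      a ≤ b := by
    intro C hC a b ha hb hab
    rcases hC.total ha hb with h | h
    · exact h
    · rcases h.eq_or_lt with rfl | h
      · exact le_rfl
      · exact absurd (hr h) (by omega)
  have hmem : ∀ {C : Set Q}, IsMaxChain (· ≤ ·) C → ∀ {c : Q},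
      (∀ x ∈ C, c ≤ x ∨ x ≤ c) → c ∈ C := by
    intro C hC c hc
    rw [hC.2 (hC.1.insert fun b hb _ => hc b hb) (Set.subset_insert c C)]
    exact Set.mem_insert c C
  have key : ∀ C : Set Q, IsMaxChain (· ≤ ·) C → r '' C = Set.Iic N := by
    intro C hC
    refine Set.Subset.antisymm ?_ fun i => ?_
    · rintro _ ⟨x, _, rfl⟩
      rw [← hN]
      exact hr.monotone (htop x)
    induction i with
    | zero => exact fun _ => ⟨bot, hmem hC fun x _ => Or.inl (hbot x), h0⟩
    | succ i ih =>
      intro hi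
      have hi : i + 1 ≤ N := hi
      obtain ⟨a, ha, hai⟩ := ih (Set.mem_Iic.2 (by omega))
      -- `b` is the next element of `C` above `a`
      obtain ⟨b, ⟨hb, hib⟩, hmin⟩ := Set.exists_min_image {x | x ∈ C ∧ i + 1 ≤ r x} r
        (Set.toFinite _) ⟨top, hmem hC fun x _ => Or.inr (htop x), by omega⟩
      have hab : a < b := lt_of_le_of_ne (hle hC.1 ha hb (by omega)) (by rintro rfl; omega)
      obtain ⟨c, hac, hcb, hc⟩ := hstep a b hab
      refine ⟨c, hmem hC fun x hx => ?_, by omega⟩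
      by_cases hxi : i + 1 ≤ r x
      · exact Or.inl (hcb.trans (hle hC.1 hb hx (hmin x ⟨hx, hxi⟩)))
      · exact Or.inr ((hle hC.1 hx ha (by omega)).trans hac.le)
  have hcard : ∀ C : Set Q, IsMaxChain (· ≤ ·) C → C.ncard = (Set.Iic N).ncard := by
    intro C hC
    rw [← key C hC]
    refine (Set.InjOn.ncard_image fun a ha b hb hab => ?_).symm
    exact le_antisymm (hle hC.1 ha hb hab.le) (hle hC.1 hb ha hab.ge)
  exact ⟨inferInstance, ⟨bot, hbot⟩, fun C D hC hD => (hcard C hC).trans (hcard D hD).symm⟩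

theorem isSymmetricChainOrder_of_graded [Finite Q] (hr : StrictMono r) (hbot : ∀ x, bot ≤ x)
    (htop : ∀ x, x ≤ top) (h0 : r bot = 0) (hN : r top = N)
    (hstep : ∀ a b, a < b → ∃ c, a < c ∧ c ≤ b ∧ r c = r a + 1)
    (h : HasSCD (⊥ : Setoid Q) (fun x => (r x : ℤ)) N) : IsSymmetricChainOrder Q := by
  have hheight := height_eq_of_graded hr hbot h0 hstep
  have hrank : posetRank Q = N := by
    refine le_antisymm (iSup_le fun x => ?_) ?_
    · rw [hheight, ← hN]
      exact_mod_cast hr.monotone (htop x)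
    · rw [← hN, ← hheight]
      exact le_iSup Order.height top
  refine ⟨isRankedPoset_of_graded hr hbot htop h0 hN hstep, ?_⟩
  obtain ⟨ι, m, c, e, h1, h2, h3, h4, h5⟩ := h
  refine ⟨Set.range fun i => Set.range fun j : Fin (m i + 1) => e i j, ⟨?_, fun x => ?_⟩, ?_⟩
  · rintro ⟨i, hi⟩
    exact (Set.range_nonempty _).ne_empty hi
  · obtain ⟨i, j, hj, hx⟩ := h1 x
    refine ⟨_, ⟨⟨i, rfl⟩, ⟨j, by omega⟩, hx⟩, ?_⟩
    rintro _ ⟨⟨i', rfl⟩, j', hx'⟩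
    obtain ⟨rfl, -⟩ := h2 i j i' j' hj (by omega) (hx.trans hx'.symm)
    rfl
  · rintro _ ⟨i, rfl⟩
    refine ⟨m i, fun j => e i j, fun j => ?_, ?_, rfl⟩
    · have hj := h4 i j (by omega)
      have hj' := h4 i (j + 1) (by omega)
      have hrj : r (e i (j + 1)) = r (e i j) + 1 := by
        dsimp only at hj hj'
        push_cast at hj'
        omega
      refine ⟨lt_of_le_of_ne (h3 i j j.2) fun h => ?_, fun y hy hy' => ?_⟩
      · have := congrArg r h
        simp only [Fin.val_castSucc, Fin.val_succ] at this
        omega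
      · have := hr hy
        have := hr hy'
        simp only [Fin.val_castSucc, Fin.val_succ] at *
        omega
    · have hj := h4 i 0 (by omega)
      have hj' := h4 i (m i) le_rfl
      have := h5 i
      rw [hheight, hheight, hrank]
      have key : r (e i 0) + r (e i (m i)) = N := by
        dsimp only at hj hj'
        push_cast at hj
        omega
      exact_mod_cast key

end Graded

/-- Orbits of subsets, under a group of automorphisms that preserve cardinality, form a poset
graded by cardinality. -/
theorem QuotientPoset.isSymmetricChainOrder_of_hasSCD {α : Type} [Finite α]
    (G : Subgroup (Set α ≃o Set α)) (hG : ∀ g ∈ G, ∀ X : Set α, (g X).ncard = X.ncard)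
    (h : HasSCD (MulAction.orbitRel G (Set α)) (fun X => (X.ncard : ℤ)) (Nat.card α)) :
    IsSymmetricChainOrder (QuotientPoset G) := by
  have : Finite (QuotientPoset G) :=
    Finite.of_surjective (QuotientPoset.mk G) Quotient.mk_surjective
  have hmk : Function.Surjective (QuotientPoset.mk G) := Quotient.mk_surjective
  let r : QuotientPoset G → ℕ := Quotient.lift (fun X : Set α => X.ncard) (by
    rintro X Y ⟨⟨g, hg⟩, rfl⟩
    exact hG g hg Y)
  have hr : ∀ X, r (QuotientPoset.mk G X) = X.ncard := fun _ => rfl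
  have hle : ∀ X Y : Set α, X ⊆ Y → QuotientPoset.mk G X ≤ QuotientPoset.mk G Y :=
    fun X Y hXY => ⟨X, Y, rfl, rfl, hXY⟩
  have hlt : ∀ a b : QuotientPoset G, a < b →
      ∃ X Y, QuotientPoset.mk G X = a ∧ QuotientPoset.mk G Y = b ∧ X ⊂ Y := by
    intro a b hab
    obtain ⟨X, Y, rfl, rfl, hXY⟩ := hab.le
    refine ⟨X, Y, rfl, rfl, LE.le.ssubset_of_ne hXY ?_⟩
    rintro rfl
    exact hab.ne rfl
  have hmono : StrictMono r := by
    intro a b hab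
    obtain ⟨X, Y, rfl, rfl, hXY⟩ := hlt a b hab
    exact Set.ncard_lt_ncard hXY
  refine isSymmetricChainOrder_of_graded (r := r) (N := Nat.card α)
    (bot := QuotientPoset.mk G ∅) (top := QuotientPoset.mk G Set.univ) hmono ?_ ?_ ?_ ?_ ?_ ?_
  · intro a
    obtain ⟨X, rfl⟩ := hmk a
    exact hle _ _ (Set.empty_subset X)
  · intro a
    obtain ⟨X, rfl⟩ := hmk a
    exact hle _ _ (Set.subset_univ X)
  · exact Set.ncard_empty α
  · exact Set.ncard_univ α
  · intro a b hab
    obtain ⟨X, Y, rfl, rfl, hXY⟩ := hlt a b hab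
    obtain ⟨y, hy, hyX⟩ := Set.exists_of_ssubset hXY
    have hcard : r (QuotientPoset.mk G (insert y X)) = r (QuotientPoset.mk G X) + 1 :=
      Set.ncard_insert_of_notMem hyX
    refine ⟨QuotientPoset.mk G (insert y X), lt_of_le_of_ne (hle _ _ (Set.subset_insert y X)) ?_,
      hle _ _ (Set.insert_subset hy hXY.subset), hcard⟩
    intro h
    rw [← h] at hcard
    omega
  · refine h.transfer (QuotientPoset.mk G) 0 (fun X Y hXY => hle X Y hXY) (fun X => ?_) (by simp)
      (fun X Y => Quotient.eq (r := MulAction.orbitRel G (Set α))) fun a => ?_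
    · rw [hr, add_zero]
    · obtain ⟨X, rfl⟩ := hmk a
      exact ⟨X, rfl⟩

open Classical in
theorem hasSCD_prop : HasSCD (⊥ : Setoid Prop) (fun p => if p then 1 else 0) 1 := by
  refine HasSCD.of_chain 1 (fun j => 0 < j) ?_ ?_ ?_ ?_
  · rintro p q rfl
    rfl
  · intro p
    by_cases hp : p
    · exact ⟨1, le_rfl, by simpa using hp⟩
    · exact ⟨0, by simp, by simpa using hp⟩
  · intro j _ _
    exact j.succ_pos
  · intro j hj
    interval_cases j <;> simp

theorem theorem1 (k t : ℕ) (hk : 0 < k) (ht : 0 < t)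
    (K : Subgroup (Equiv.Perm (Fin k))) (T : Subgroup (Equiv.Perm (Fin t)))
    (hK : IsGeneratedByPowersOfDisjointCycles K) (hT : IsGeneratedByPowersOfDisjointCycles T) :
    IsSymmetricChainOrder
      (QuotientPoset ((wreathProduct K T).map (permToAut (Fin k × Fin t)))) := by
  apply QuotientPoset.isSymmetricChainOrder_of_hasSCD
  · rintro _ ⟨φ, _, rfl⟩ X
    exact Set.ncard_image_of_injective X φ.injective
  -- a subset of `[k] × [t]` is a function `[t] → ([k] → Prop)`
  have h := (hasSCD_prop.fun_of_disjoint_cycles hK).fun_of_disjoint_cycles hT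
  refine h.transfer (fun x => {p | x p.2 p.1}) 0 (fun x y hxy p => hxy p.2 p.1) ?_ ?_ ?_ ?_
  · intro x
    classical
    rw [Set.ncard_eq_toFinset_card', Set.toFinset_ofPred, Finset.card_filter,
      Fintype.sum_prod_type_right, add_zero]
    push_cast
    rfl
  · simp [mul_comm]
  · intro x y
    rw [Setoid.comm']
    constructor
    · rintro ⟨⟨_, φ, ⟨ρ, τ, hρ, hτ, hφ⟩, rfl⟩, h⟩
      have h : φ '' {p : Fin k × Fin t | x p.2 p.1} = {p | y p.2 p.1} := h
      refine ⟨⟨τ, hτ⟩, fun r => ⟨⟨ρ r, hρ r⟩, fun i => propext ?_⟩⟩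
      change (i, r) ∈ {p : Fin k × Fin t | x p.2 p.1} ↔ (ρ r i, τ r) ∈ {p | y p.2 p.1}
      rw [← h, ← hφ, φ.injective.mem_set_image]
    · rintro ⟨⟨τ, hτ⟩, h⟩
      choose ρ hρ using h
      let φ : Equiv.Perm (Fin k × Fin t) := (Equiv.prodComm _ _).trans
        ((Equiv.prodShear τ fun r => (ρ r).1).trans (Equiv.prodComm _ _))
      refine ⟨⟨_, φ, ⟨fun r => (ρ r).1, τ, fun r => (ρ r).2, hτ, fun i r => rfl⟩, rfl⟩, ?_⟩
      change φ '' {p : Fin k × Fin t | x p.2 p.1} = {p | y p.2 p.1}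
      rw [Equiv.image_eq_preimage_symm]
      ext p
      obtain ⟨⟨i, r⟩, rfl⟩ := φ.surjective p
      rw [Set.mem_preimage, Equiv.symm_apply_apply]
      exact (hρ r i).to_iff
  · exact fun X => ⟨fun r i => (i, r) ∈ X, Setoid.refl' _ _⟩
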